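/- Let $n\ge 2$. Let $p$ be a pressure law that is smooth on $(0,\infty)$ with $p'>0$ and $p''>0$ there, let $h(\rho)=\int_1^\rho p'(s)/s\,ds$ be the enthalpy and $c(\rho)=\sqrt{p'(\rho)}$ the sound speed, and let $B$ be a value of $h$ on $(0,\infty)$ (the Bernoulli constant). For $q\ge 0$ let $\rho(q^2)>0$ be the solution of $\tfrac12 q^2+h(\rho(q^2))=B$, where it exists. Call $q$ subsonic if $\rho(q^2)$ exists and $q<c(\rho(q^2))$. Let $S\subset\mathbb R^{n-1}$ be a bounded, simply connected domain with $C^{2,\alpha}$ boundary, $0<\alpha<1$, let $|S|$ be its $(n-1)$-dimensional measure, $\Omega=S\times\mathbb R$, and $m_0>0$. A solution of the nozzle problem with mass flux $m_0$ is a function $\varphi\in C^2(\Omega)\cap C^1(\overline\Omega)$ such that $$\operatorname{div}\big(\rho(|\nabla\varphi|^2)\nabla\varphi\big)=0\ \text{ in }\Omega,\qquad \frac{\partial\varphi}{\partial\vec n}=0\ \text{ on }\partial\Omega,\qquad |\nabla\varphi|\ \text{ is subsonic at every point of }\Omega,$$ $$\int_{S\times\{t\}}\rho(|\nabla\varphi|^2)\,\frac{\partial\varphi}{\partial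 x_n}\,dx'=m_0\quad\text{for every }t\in\mathbb R.$$ Then there is a critical speed $q_{cr}>0$ such that $q\ge 0$ is subsonic if and only if $q<q_{cr}$, and the following holds. If $m_0/|S|<\rho(q_{cr}^2)q_{cr}$, there is exactly one $q_0\in(0,q_{cr})$ with $$\rho(q_0^2)\,q_0=\frac{m_0}{|S|},$$ and the solutions of the nozzle problem are exactly the functions $$\varphi=q_0x_n+\varphi_0\quad\text{on }\overline\Omega,\qquad \varphi_0\in\mathbb R\text{ an arbitrary constant};$$ in particular the solution is unique up to a constant and uniformly subsonic, i.e. $\sup_\Omega|\nabla\varphi|<q_{cr}$. If $m_0/|S|\ge\rho(q_{cr}^2)q_{cr}$, the nozzle problem has no solution. -/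

import Mathlib

open Set MeasureTheory Topology
open scoped NNReal ContDiff

noncomputable section

/-! ### The gas -/

/-- A pressure law `p = p(ρ)`: smooth on `ρ > 0` with `p' > 0` and `p'' > 0` there. -/
structure IsPressureLaw (p : ℝ → ℝ) : Prop where
  smooth : ContDiffOn ℝ ∞ p (Ioi 0)
  deriv_pos : ∀ r, 0 < r → 0 < deriv p r
  deriv_deriv_pos : ∀ r, 0 < r → 0 < deriv (deriv p) r

/-- The enthalpy `h(ρ) = ∫₁^ρ p'(s) / s ds`. -/
def enthalpy (p : ℝ → ℝ) (r : ℝ) : ℝ := ∫ s in (1 : ℝ)..r, deriv p s / s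

/-- The local sound speed `c(ρ) = √(p'(ρ))`. -/
def soundSpeed (p : ℝ → ℝ) (r : ℝ) : ℝ := Real.sqrt (deriv p r)

open Classical in
/-- The density as a function of the squared speed `s = q²` for a flow with Bernoulli constant `B`:
the positive solution `r` of Bernoulli's law `s / 2 + h(r) = B`
(unique, since `h` is strictly increasing), and `0` if there is none (vacuum). -/
def density (p : ℝ → ℝ) (B s : ℝ) : ℝ :=
  if H : ∃ r : ℝ, 0 < r ∧ s / 2 + enthalpy p r = B then H.choose else 0

/-- The speed `q` is attained away from vacuum and is smaller than the local sound speed. -/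
def IsSubsonicSpeed (p : ℝ → ℝ) (B q : ℝ) : Prop :=
  0 < density p B (q ^ 2) ∧ q < soundSpeed p (density p B (q ^ 2))

/-! ### Domains -/

/-- On the open set `U`, `g` is a `C¹` function without critical points that is negative exactly
on the part of `Ω` in `U`; so `∂Ω ∩ U = {g = 0}` and `Ω` lies on one side of it. -/
structure IsLocalDefiningFunction {n : ℕ} (Ω U : Set (EuclideanSpace ℝ (Fin n)))
    (g : EuclideanSpace ℝ (Fin n) → ℝ) : Prop where
  isOpen : IsOpen U
  contDiffOn : ContDiffOn ℝ 1 g U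
  gradient_ne_zero : ∀ y ∈ U, gradient g y ≠ 0
  inter_eq : Ω ∩ U = {y | y ∈ U ∧ g y < 0}

/-- `S` is open and its boundary is locally the zero set of a `C^{2,α}` defining function. -/
def IsC2HolderOpen {n : ℕ} (α : ℝ≥0) (S : Set (EuclideanSpace ℝ (Fin n))) : Prop :=
  IsOpen S ∧ ∀ x ∈ frontier S, ∃ (U : Set (EuclideanSpace ℝ (Fin n)))
    (g : EuclideanSpace ℝ (Fin n) → ℝ) (C : ℝ≥0), x ∈ U ∧ IsLocalDefiningFunction S U g ∧
      ContDiffOn ℝ 2 g U ∧ HolderOnWith C α (iteratedFDeriv ℝ 2 g) U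

/-- `ν` is the unit outer normal of `Ω` at the boundary point `x`. -/
def IsOuterUnitNormal {n : ℕ} (Ω : Set (EuclideanSpace ℝ (Fin n)))
    (x ν : EuclideanSpace ℝ (Fin n)) : Prop :=
  ∃ (U : Set (EuclideanSpace ℝ (Fin n))) (g : EuclideanSpace ℝ (Fin n) → ℝ),
    x ∈ U ∧ IsLocalDefiningFunction Ω U g ∧ ν = ‖gradient g x‖⁻¹ • gradient g x

/-- The point `(x', t)` of `ℝ^{d+1} = ℝ^d × ℝ`. -/
def axialPoint {d : ℕ} (x' : EuclideanSpace ℝ (Fin d)) (t : ℝ) : EuclideanSpace ℝ (Fin (d + 1)) :=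
  WithLp.toLp 2 (Fin.snoc (α := fun _ => ℝ) (fun i => x' i) t)

/-- The straight cylinder `S × ℝ` in `ℝ^{d+1}`; the axial coordinate is the last one. -/
def straightCylinder {d : ℕ} (S : Set (EuclideanSpace ℝ (Fin d))) :
    Set (EuclideanSpace ℝ (Fin (d + 1))) :=
  {x | ∃ x' ∈ S, ∃ t : ℝ, x = axialPoint x' t}

/-! ### The nozzle problem -/

/-- The divergence `∑ᵢ ∂ᵢ Fᵢ`. -/
def divergence {n : ℕ} (F : EuclideanSpace ℝ (Fin n) → EuclideanSpace ℝ (Fin n))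
    (x : EuclideanSpace ℝ (Fin n)) : ℝ :=
  ∑ i : Fin n, (fderiv ℝ F x (EuclideanSpace.single i 1)) i

/-- The mass flux density `ρ(|∇φ|²) ∇φ`. -/
def massFlux {n : ℕ} (p : ℝ → ℝ) (B : ℝ) (φ : EuclideanSpace ℝ (Fin n) → ℝ)
    (x : EuclideanSpace ℝ (Fin n)) : EuclideanSpace ℝ (Fin n) :=
  density p B (‖gradient φ x‖ ^ 2) • gradient φ x

/-- `φ ∈ C²(Ω) ∩ C¹(closure Ω)` is a classical solution of the nozzle problem in `Ω` with mass
flux `m₀`. Membership in `C¹(closure Ω)` means that `φ` and `∇φ` extend continuously to the closure;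
`G` is the extension of `∇φ`, which gives the normal derivative on the boundary. -/
structure IsNozzleFlow {d : ℕ} (p : ℝ → ℝ) (B : ℝ) (Ω : Set (EuclideanSpace ℝ (Fin (d + 1))))
    (m₀ : ℝ) (φ : EuclideanSpace ℝ (Fin (d + 1)) → ℝ) : Prop where
  contDiffOn : ContDiffOn ℝ 2 φ Ω
  continuousOn : ContinuousOn φ (closure Ω)
  potential_eq : ∀ x ∈ Ω, divergence (massFlux p B φ) x = 0
  slip : ∃ G : EuclideanSpace ℝ (Fin (d + 1)) → EuclideanSpace ℝ (Fin (d + 1)),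
    ContinuousOn G (closure Ω) ∧ EqOn G (gradient φ) Ω ∧
      ∀ x ∈ frontier Ω, ∀ ν, IsOuterUnitNormal Ω x ν → inner ℝ (G x) ν = 0
  /-- The flux through every cross section `Ω ∩ {xₙ = t}` is `m₀`. -/
  flux : ∀ t : ℝ, ∫ x' in {x' : EuclideanSpace ℝ (Fin d) | axialPoint x' t ∈ Ω},
    (massFlux p B φ (axialPoint x' t)) (Fin.last d) = m₀
  subsonic : ∀ x ∈ Ω, IsSubsonicSpeed p B ‖gradient φ x‖

end

/-! ### The gas -/

/-! Uniqueness comes from comparing a nozzle flow with the uniform flow `w = q₀ e`, `e` the axial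
direction, of the same mass flux. Put `F = ρ(|∇φ|²)∇φ - ρ(|w|²)w` and `u = φ - q₀ xₙ`. Then `F` is
divergence free, tangential to the lateral boundary (normals of a straight cylinder are orthogonal
to the axis, so `w` is tangential too), and has zero flux through every cross section. Since `|∇φ| <
qcr` and `S` is bounded, connected and has `C¹` boundary, `u` has oscillation at most `K` on each
cross section, with one `K` for all of them (`HasC1Boundary.exists_osc_bound`).

Testing `div F = 0` with `u` times a cutoff in `xₙ` that falls from `1` to `0` over `T ≤ |xₙ| ≤ T +
1` leaves only terms with the derivative of the cutoff. Because `F` has no net flux, a function of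
`xₙ` may be subtracted from `u` there, so the energy `∫ ∇u · F` over `|xₙ| < T` is at most `K ∫ |F|`
over the two end slabs (`IsEnergyPair.integral_trapezoid_mul_le`).

The flow is not assumed uniformly subsonic, and the strong monotonicity of `v ↦ ρ(|v|²)v`
degenerates at the sonic speed. Its cocoercivity does not: `|F|² ≤ ρ(0) ∇u · F` holds up to and
including `qcr` (`IsCriticalSpeed.cocoercive`). Hence `|F| ≤ λ + (ρ(0)/λ) ∇u · F` for every `λ > 0`.
The energies of growing cylinders are bounded and increasing, so their increments tend to zero;
letting `λ → 0` afterwards makes the energy vanish (`IsEnergyPair.energy_eq_zero`). Then `F = 0`,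
and injectivity of the flux map gives `∇φ = w`.

The gas enters only through `IsCriticalSpeed`: up to `qcr` the density decreases with the speed and
the flux density `ρ(q²)q` strictly increases. This also yields `q₀`, and it excludes `m₀/|S| ≥
ρ(qcr²)qcr`, because a subsonic flow has flux density strictly below the sonic value everywhere.

The divergence theorem is needed for fields that are `C¹` inside and merely continuous up to the
boundary. `HasC1Boundary.integral_mul_divergence` obtains it from cutoffs in the distance to the
complement: the gradient of that distance is normal at a nearest boundary point, where the field has
no normal component, and a boundary strip has volume of the order of its width. -/

theorem IsPressureLaw.contDiffOn_deriv {p : ℝ → ℝ} (hp : IsPressureLaw p) :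
    ContDiffOn ℝ ∞ (deriv p) (Ioi 0) :=
  hp.smooth.deriv_of_isOpen isOpen_Ioi (by simp)

theorem IsPressureLaw.continuousOn_deriv {p : ℝ → ℝ} (hp : IsPressureLaw p) :
    ContinuousOn (deriv p) (Ioi 0) := hp.contDiffOn_deriv.continuousOn

theorem IsPressureLaw.strictMonoOn_deriv {p : ℝ → ℝ} (hp : IsPressureLaw p) :
    StrictMonoOn (deriv p) (Ioi 0) :=
  strictMonoOn_of_deriv_pos (convex_Ioi 0) hp.continuousOn_deriv fun x hx =>
    hp.deriv_deriv_pos x (by simpa using hx)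

theorem IsPressureLaw.continuousOn_deriv_div {p : ℝ → ℝ} (hp : IsPressureLaw p) :
    ContinuousOn (fun s => deriv p s / s) (Ioi 0) :=
  hp.continuousOn_deriv.div continuousOn_id fun _ hx => ne_of_gt hx

theorem IsPressureLaw.hasDerivAt_enthalpy {p : ℝ → ℝ} (hp : IsPressureLaw p) {r : ℝ}
    (hr : 0 < r) : HasDerivAt (enthalpy p) (deriv p r / r) r := by
  have hc := hp.continuousOn_deriv_div
  refine intervalIntegral.integral_hasDerivAt_right ?_ ?_ ?_
  · refine (hc.mono ?_).intervalIntegrable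
    intro x hx
    exact lt_of_lt_of_le (lt_min one_pos hr) (by simpa using hx.1)
  · exact hc.stronglyMeasurableAtFilter isOpen_Ioi r hr
  · exact hc.continuousAt (Ioi_mem_nhds hr)

theorem IsPressureLaw.contDiffOn_enthalpy {p : ℝ → ℝ} (hp : IsPressureLaw p) :
    ContDiffOn ℝ 1 (enthalpy p) (Ioi 0) := by
  rw [show (1 : WithTop ℕ∞) = 0 + 1 from rfl, contDiffOn_succ_iff_deriv_of_isOpen isOpen_Ioi]
  refine ⟨fun x hx => (hp.hasDerivAt_enthalpy hx).differentiableAt.differentiableWithinAt,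
    by simp, contDiffOn_zero.2 ?_⟩
  exact hp.continuousOn_deriv_div.congr fun x hx => (hp.hasDerivAt_enthalpy hx).deriv

theorem IsPressureLaw.continuousOn_enthalpy {p : ℝ → ℝ} (hp : IsPressureLaw p) :
    ContinuousOn (enthalpy p) (Ioi 0) := hp.contDiffOn_enthalpy.continuousOn

theorem IsPressureLaw.strictMonoOn_enthalpy {p : ℝ → ℝ} (hp : IsPressureLaw p) :
    StrictMonoOn (enthalpy p) (Ioi 0) :=
  strictMonoOn_of_deriv_pos (convex_Ioi 0) hp.continuousOn_enthalpy fun x hx => by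
    have hx : 0 < x := by simpa using hx
    rw [(hp.hasDerivAt_enthalpy hx).deriv]
    exact div_pos (hp.deriv_pos x hx) hx

/-- Strict monotonicity of the enthalpy makes the choice in `density` irrelevant. -/
theorem IsPressureLaw.density_eq {p : ℝ → ℝ} (hp : IsPressureLaw p) {B s r : ℝ} (hr : 0 < r)
    (h : s / 2 + enthalpy p r = B) : density p B s = r := by
  have H : ∃ r : ℝ, 0 < r ∧ s / 2 + enthalpy p r = B := ⟨r, hr, h⟩
  rw [density, dif_pos H]
  have h2 := H.choose_spec
  exact hp.strictMonoOn_enthalpy.injOn h2.1 hr (by linarith [h2.2])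

/-- A positive value excludes the default `0`, so Bernoulli's law is available. -/
theorem bernoulli_of_density_pos {p : ℝ → ℝ} {B s : ℝ} (h : 0 < density p B s) :
    s / 2 + enthalpy p (density p B s) = B := by
  by_cases H : ∃ r : ℝ, 0 < r ∧ s / 2 + enthalpy p r = B
  · have h2 := H.choose_spec
    rw [density, dif_pos H]
    exact h2.2
  · rw [density, dif_neg H] at h
    exact absurd h (lt_irrefl 0)

/-- The density locally inverts `r ↦ 2 (B - h(r))`, whose derivative `-2 p'(r)/r` does not vanish;
this is the inverse function theorem. -/
theorem IsPressureLaw.contDiffAt_density {p : ℝ → ℝ} (hp : IsPressureLaw p) {B s : ℝ}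
    (h : 0 < density p B s) : ContDiffAt ℝ 1 (density p B) s := by
  set r := density p B s with hr
  set f : ℝ → ℝ := fun r => 2 * (B - enthalpy p r) with hf
  have hfr : f r = s := by
    have := bernoulli_of_density_pos h
    simp only [hf]; linarith
  have hfc : ContDiffAt ℝ 1 f r :=
    contDiffAt_const.mul (contDiffAt_const.sub (hp.contDiffOn_enthalpy.contDiffAt (Ioi_mem_nhds h)))
  have hd : HasDerivAt f (2 * (0 - deriv p r / r)) r :=
    ((hasDerivAt_const r B).sub (hp.hasDerivAt_enthalpy h)).const_mul 2
  have hne : 2 * (0 - deriv p r / r) ≠ 0 := by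
    have := div_pos (hp.deriv_pos r h) h
    linarith
  have hd' : HasFDerivAt f ((ContinuousLinearEquiv.unitsEquivAut ℝ (Units.mk0 _ hne) :
      ℝ ≃L[ℝ] ℝ) : ℝ →L[ℝ] ℝ) r := by
    have := hd.hasFDerivAt
    convert! this using 1
  have hloc := hfc.to_localInverse hd' one_ne_zero
  rw [hfr] at hloc
  refine hloc.congr_of_eventuallyEq ?_
  have h1 : Filter.Tendsto (hfc.localInverse hd' one_ne_zero) (𝓝 s) (𝓝 r) := by
    have := hloc.continuousAt.tendsto
    have h3 := hfc.localInverse_apply_image hd' one_ne_zero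
    rw [hfr] at h3
    rwa [h3] at this
  have h2 : ∀ᶠ y in 𝓝 s, f (hfc.localInverse hd' one_ne_zero y) = y := by
    have := (hfc.hasStrictFDerivAt' hd' one_ne_zero).eventually_right_inverse
    rwa [hfr] at this
  filter_upwards [h1.eventually (Ioi_mem_nhds h), h2] with y hy1 hy2
  refine hp.density_eq hy1 ?_
  simp only [hf] at hy2
  linarith

/-- `r ↦ r² (B - h(r))` is, up to a factor, the squared mass flux density. -/
theorem IsPressureLaw.hasDerivAt_sq_mul {p : ℝ → ℝ} (hp : IsPressureLaw p) (B : ℝ) {r : ℝ}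
    (hr : 0 < r) : HasDerivAt (fun r => r ^ 2 * (B - enthalpy p r))
      (r * (2 * (B - enthalpy p r) - deriv p r)) r := by
  have := (hasDerivAt_pow 2 r).mul ((hasDerivAt_const r B).sub (hp.hasDerivAt_enthalpy hr))
  convert! this using 1
  field_simp
  simp
  ring

/-! ### The sonic state and the critical speed -/

/-- At density `r` Bernoulli's law gives the squared speed `2 (B - h(r))`. At rest, `r = rB`, it is
below the squared sound speed `p'(r)`; at some smaller density it must be above. The intermediate
value theorem gives a sonic state between them. -/
theorem IsPressureLaw.exists_critical_density {p : ℝ → ℝ} (hp : IsPressureLaw p) {B rB : ℝ}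
    (hrB : 0 < rB) (hB : enthalpy p rB = B) :
    ∃ rc, 0 < rc ∧ rc < rB ∧ 2 * (B - enthalpy p rc) = deriv p rc := by
  have hk : ContinuousOn (fun r => enthalpy p r + deriv p r / 2) (Ioi 0) :=
    hp.continuousOn_enthalpy.add (hp.continuousOn_deriv.div_const 2)
  -- No behaviour of `p` at vacuum is prescribed. If every state below `rB` were at most sonic, `r²
  -- (B - h(r))` would be nonincreasing on `(0, rB/2]`, hence at least a constant `c > 0` there; but
  -- it would also be at most `r² p'(rB/2)/2`, since `p'` increases, and this tends to `0`.
  have key : ∃ r, 0 < r ∧ r < rB ∧ enthalpy p r + deriv p r / 2 < B := by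
    by_contra! hcon
    set r1 := rB / 2 with hr1
    have hr1pos : 0 < r1 := by positivity
    have hr1B : r1 < rB := by linarith
    have hanti : AntitoneOn (fun r => r ^ 2 * (B - enthalpy p r)) (Ioc 0 r1) := by
      refine antitoneOn_of_deriv_nonpos (convex_Ioc 0 r1) ?_ ?_ ?_
      · exact fun x hx => (hp.hasDerivAt_sq_mul B hx.1).continuousAt.continuousWithinAt
      · intro x hx
        rw [interior_Ioc] at hx
        exact (hp.hasDerivAt_sq_mul B hx.1).differentiableAt.differentiableWithinAt
      · intro x hx
        rw [interior_Ioc] at hx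
        rw [(hp.hasDerivAt_sq_mul B hx.1).deriv]
        have := hcon x hx.1 (hx.2.trans hr1B)
        exact mul_nonpos_of_nonneg_of_nonpos hx.1.le (by linarith)
    set c := r1 ^ 2 * (B - enthalpy p r1) with hc
    have hcpos : 0 < c := by
      have := hp.strictMonoOn_enthalpy hr1pos hrB hr1B
      have : 0 < B - enthalpy p r1 := by linarith
      positivity
    have hlim : Filter.Tendsto (fun r : ℝ => r ^ 2 * (deriv p r1 / 2)) (𝓝[>] 0) (𝓝 0) := by
      have : Continuous fun r : ℝ => r ^ 2 * (deriv p r1 / 2) := by fun_prop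
      have h := (this.tendsto 0).mono_left (nhdsWithin_le_nhds (s := Ioi (0 : ℝ)))
      simpa using h
    obtain ⟨r, hr, hrlt⟩ := ((hlim.eventually (Iio_mem_nhds hcpos)).and
      (Ioo_mem_nhdsGT hr1pos)).exists
    have h1 : c ≤ r ^ 2 * (B - enthalpy p r) :=
      hanti ⟨hrlt.1, hrlt.2.le⟩ ⟨hr1pos, le_rfl⟩ hrlt.2.le
    have h2 := hcon r hrlt.1 (hrlt.2.trans hr1B)
    have h3 := hp.strictMonoOn_deriv hrlt.1 hr1pos hrlt.2
    have h4 : r ^ 2 * (B - enthalpy p r) ≤ r ^ 2 * (deriv p r1 / 2) := by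
      gcongr; linarith
    have hr : r ^ 2 * (deriv p r1 / 2) < c := hr
    linarith
  obtain ⟨r, hr, hrB', hlt⟩ := key
  have hgt : B < enthalpy p rB + deriv p rB / 2 := by
    have := hp.deriv_pos rB hrB
    linarith
  obtain ⟨rc, hrc, hrc2⟩ := intermediate_value_Ioo hrB'.le
    (hk.mono fun x hx => lt_of_lt_of_le hr hx.1) ⟨hlt, hgt⟩
  refine ⟨rc, hr.trans hrc.1, hrc.2, ?_⟩
  simp only at hrc2
  linarith

/-- The properties of the density that the flow problem uses. -/
structure IsCriticalSpeed (p : ℝ → ℝ) (B qcr : ℝ) : Prop where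
  pos : 0 < qcr
  subsonic_iff : ∀ q, 0 ≤ q → (IsSubsonicSpeed p B q ↔ q < qcr)
  density_pos : ∀ q ∈ Icc 0 qcr, 0 < density p B (q ^ 2)
  density_anti : AntitoneOn (fun q => density p B (q ^ 2)) (Icc 0 qcr)
  flux_strictMono : StrictMonoOn (fun q => density p B (q ^ 2) * q) (Icc 0 qcr)
  flux_continuousOn : ContinuousOn (fun q => density p B (q ^ 2) * q) (Icc 0 qcr)
  contDiffAt : ∀ q ∈ Icc 0 qcr, ContDiffAt ℝ 1 (density p B) (q ^ 2)

/-- The critical speed is the sound speed at the sonic density `rc`. Speeds in `[0, qcr]` correspond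
to densities in `[rc, rB]`, in reverse order. All properties include the endpoint `qcr`, because the
velocity on the lateral boundary is only a limit of subsonic velocities. -/
theorem IsPressureLaw.exists_isCriticalSpeed {p : ℝ → ℝ} (hp : IsPressureLaw p) {B : ℝ}
    (hB : ∃ r : ℝ, 0 < r ∧ enthalpy p r = B) : ∃ qcr, IsCriticalSpeed p B qcr := by
  obtain ⟨rB, hrB, hB⟩ := hB
  obtain ⟨rc, hrc, hrcB, hcrit⟩ := hp.exists_critical_density hrB hB
  have hp' := hp.deriv_pos rc hrc
  set qcr := Real.sqrt (deriv p rc) with hq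
  have hqsq : qcr ^ 2 = deriv p rc := Real.sq_sqrt hp'.le
  have hqpos : 0 < qcr := Real.sqrt_pos.2 hp'
  -- the density of a speed up to `qcr`
  have hex : ∀ q ∈ Icc 0 qcr, rc ≤ density p B (q ^ 2) ∧
      q ^ 2 / 2 + enthalpy p (density p B (q ^ 2)) = B := by
    intro q hq
    have h1 : q ^ 2 ≤ qcr ^ 2 := pow_le_pow_left₀ hq.1 hq.2 2
    have h2 : B - q ^ 2 / 2 ∈ Icc (enthalpy p rc) (enthalpy p rB) :=
      ⟨by linarith, by nlinarith [sq_nonneg q]⟩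
    obtain ⟨r, hr, hr2⟩ := intermediate_value_Icc hrcB.le
      (hp.continuousOn_enthalpy.mono fun x hx => lt_of_lt_of_le hrc hx.1) h2
    have hr0 := lt_of_lt_of_le hrc hr.1
    have h3 : q ^ 2 / 2 + enthalpy p r = B := by linarith
    rw [hp.density_eq hr0 h3]
    exact ⟨hr.1, h3⟩
  have hdpos : ∀ q ∈ Icc 0 qcr, 0 < density p B (q ^ 2) :=
    fun q hq => lt_of_lt_of_le hrc (hex q hq).1
  have hdanti : StrictAntiOn (fun q => density p B (q ^ 2)) (Icc 0 qcr) := by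
    intro a ha b hb hab
    have h1 := (hex a ha).2
    have h2 := (hex b hb).2
    have h3 : a ^ 2 < b ^ 2 := pow_lt_pow_left₀ hab ha.1 two_ne_zero
    by_contra! hcon
    have := hp.strictMonoOn_enthalpy.monotoneOn (hdpos a ha) (hdpos b hb) hcon
    linarith
  have hcd : ∀ q ∈ Icc 0 qcr, ContDiffAt ℝ 1 (density p B) (q ^ 2) :=
    fun q hq => hp.contDiffAt_density (hdpos q hq)
  refine ⟨qcr, hqpos, ?_, hdpos, hdanti.antitoneOn, ?_, ?_, hcd⟩
  · intro q hq
    have haux : ∀ r, 0 < r → (q < soundSpeed p r ↔ q ^ 2 < deriv p r) :=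
      fun r hr => Real.lt_sqrt hq
    constructor
    · rintro ⟨h1, h2⟩
      rw [haux _ h1] at h2
      have h3 := bernoulli_of_density_pos h1
      -- At a density not above `rc`, Bernoulli's law gives `q² ≥ p'(rc) ≥ p'(ρ)`, which is not
      -- subsonic.
      have h4 : rc < density p B (q ^ 2) := by
        by_contra! hcon
        have h5 := hp.strictMonoOn_enthalpy.monotoneOn h1 hrc hcon
        have h6 := hp.strictMonoOn_deriv.monotoneOn h1 hrc hcon
        linarith
      have h5 := hp.strictMonoOn_enthalpy hrc h1 h4
      refine lt_of_pow_lt_pow_left₀ 2 hqpos.le ?_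
      linarith
    · intro h
      have hmem : q ∈ Icc 0 qcr := ⟨hq, h.le⟩
      refine ⟨hdpos q hmem, (haux _ (hdpos q hmem)).2 ?_⟩
      have h1 : q ^ 2 < qcr ^ 2 := pow_lt_pow_left₀ h hq two_ne_zero
      have h2 := hp.strictMonoOn_deriv.monotoneOn hrc (hdpos q hmem) (hex q hmem).1
      linarith
  · intro a ha b hb hab
    -- By Bernoulli's law `ρ² (B - h(ρ)) = (ρ q)² / 2`. This decreases in `ρ` beyond `rc`, while `ρ`
    -- decreases in `q`, so the flux increases with `q`.
    have hm : StrictAntiOn (fun r => r ^ 2 * (B - enthalpy p r)) (Ici rc) := by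
      refine strictAntiOn_of_deriv_neg (convex_Ici rc) ?_ ?_
      · exact fun x hx =>
          (hp.hasDerivAt_sq_mul B (lt_of_lt_of_le hrc hx)).continuousAt.continuousWithinAt
      · intro x hx
        rw [interior_Ici] at hx
        have hx' : rc < x := hx
        have hx0 : 0 < x := hrc.trans hx'
        rw [(hp.hasDerivAt_sq_mul B hx0).deriv]
        have h1 := hp.strictMonoOn_enthalpy hrc hx0 hx'
        have h2 := hp.strictMonoOn_deriv hrc hx0 hx'
        exact mul_neg_of_pos_of_neg hx0 (by linarith)
    have h1 := hm (hex b hb).1 (hex a ha).1 (hdanti ha hb hab)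
    have ha2 := (hex a ha).2
    have hb2 := (hex b hb).2
    have h2 : (density p B (a ^ 2) * a) ^ 2 < (density p B (b ^ 2) * b) ^ 2 := by
      simp only at h1
      rw [show B - enthalpy p (density p B (a ^ 2)) = a ^ 2 / 2 by linarith,
        show B - enthalpy p (density p B (b ^ 2)) = b ^ 2 / 2 by linarith] at h1
      rw [mul_pow, mul_pow]; linarith
    exact lt_of_pow_lt_pow_left₀ 2 (mul_nonneg (hdpos b hb).le hb.1) h2
  · intro q hq
    refine ContinuousAt.continuousWithinAt ?_
    refine ContinuousAt.mul ?_ continuousAt_id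
    exact ContinuousAt.comp (f := fun q : ℝ => q ^ 2) (hcd q hq).continuousAt (by fun_prop)

/-! ### Domains with `C¹` boundary -/

/-- The boundary of `Ω` is locally the zero set of a `C¹` defining function. -/
def HasC1Boundary {n : ℕ} (Ω : Set (EuclideanSpace ℝ (Fin n))) : Prop :=
  ∀ x ∈ frontier Ω, ∃ (U : Set (EuclideanSpace ℝ (Fin n))) (g : EuclideanSpace ℝ (Fin n) → ℝ),
    x ∈ U ∧ IsLocalDefiningFunction Ω U g

theorem IsC2HolderOpen.hasC1Boundary {n : ℕ} {α : ℝ≥0} {S : Set (EuclideanSpace ℝ (Fin n))}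
    (hS : IsC2HolderOpen α S) : HasC1Boundary S := fun x hx => by
  obtain ⟨U, g, _, hxU, hg, _⟩ := hS.2 x hx
  exact ⟨U, g, hxU, hg⟩

namespace IsLocalDefiningFunction

variable {n : ℕ} {Ω U : Set (EuclideanSpace ℝ (Fin n))} {g : EuclideanSpace ℝ (Fin n) → ℝ}

theorem contDiffAt (h : IsLocalDefiningFunction Ω U g) {x : EuclideanSpace ℝ (Fin n)}
    (hx : x ∈ U) : ContDiffAt ℝ 1 g x :=
  h.contDiffOn.contDiffAt (h.isOpen.mem_nhds hx)

theorem differentiableAt (h : IsLocalDefiningFunction Ω U g) {x : EuclideanSpace ℝ (Fin n)}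
    (hx : x ∈ U) : DifferentiableAt ℝ g x :=
  (h.contDiffAt hx).differentiableAt one_ne_zero

theorem neg_of_mem (h : IsLocalDefiningFunction Ω U g) {x : EuclideanSpace ℝ (Fin n)}
    (hxU : x ∈ U) (hx : x ∈ Ω) : g x < 0 := by
  have : x ∈ Ω ∩ U := ⟨hx, hxU⟩
  rw [h.inter_eq] at this
  exact this.2

theorem mem_of_neg (h : IsLocalDefiningFunction Ω U g) {x : EuclideanSpace ℝ (Fin n)}
    (hxU : x ∈ U) (hx : g x < 0) : x ∈ Ω := by
  have : x ∈ {y | y ∈ U ∧ g y < 0} := ⟨hxU, hx⟩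
  rw [← h.inter_eq] at this
  exact this.1

theorem nonneg_of_notMem (h : IsLocalDefiningFunction Ω U g) {x : EuclideanSpace ℝ (Fin n)}
    (hxU : x ∈ U) (hx : x ∉ Ω) : 0 ≤ g x := by
  by_contra! hcon
  exact hx (h.mem_of_neg hxU hcon)

theorem eq_zero_of_mem_frontier (h : IsLocalDefiningFunction Ω U g) (hΩ : IsOpen Ω)
    {x : EuclideanSpace ℝ (Fin n)} (hxU : x ∈ U) (hx : x ∈ frontier Ω) : g x = 0 := by
  rw [hΩ.frontier_eq] at hx
  refine le_antisymm ?_ (h.nonneg_of_notMem hxU hx.2)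
  have hcl : x ∈ closure (Ω ∩ U) := by
    rw [mem_closure_iff_nhds]
    intro t ht
    obtain ⟨y, hy⟩ := mem_closure_iff_nhds.1 hx.1 (t ∩ U) (Filter.inter_mem ht (h.isOpen.mem_nhds hxU))
    exact ⟨y, hy.1.1, hy.2, hy.1.2⟩
  have hc : ContinuousWithinAt g (Ω ∩ U) x := (h.differentiableAt hxU).continuousAt.continuousWithinAt
  have : (𝓝[Ω ∩ U] x).NeBot := mem_closure_iff_nhdsWithin_neBot.1 hcl
  refine le_of_tendsto hc ?_
  filter_upwards [self_mem_nhdsWithin] with y hy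
  exact (h.neg_of_mem hy.2 hy.1).le

/-- Uniform interior cone condition near a boundary point. -/
theorem exists_cone (h : IsLocalDefiningFunction Ω U g) {x : EuclideanSpace ℝ (Fin n)}
    (hxU : x ∈ U) : ∃ (r κ : ℝ) (e : EuclideanSpace ℝ (Fin n)), 0 < r ∧ 0 < κ ∧
      ∀ y ∈ Ω ∩ Metric.ball x r, ∀ s ∈ Ioc 0 r, Metric.ball (y - s • e) (κ * s) ⊆ Ω := by
  -- `e` points outwards and is not normalised, so the constants below involve its length `m`.
  set e := gradient g x with he
  set m := ‖e‖ with hm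
  have hmpos : 0 < m := norm_pos_iff.2 (h.gradient_ne_zero x hxU)
  have hstrict : HasStrictFDerivAt g (fderiv ℝ g x) x :=
    (h.contDiffAt hxU).hasStrictFDerivAt one_ne_zero
  have hlo := hstrict.isLittleO.def (show 0 < m / 4 by positivity)
  have hU : ∀ᶠ q : EuclideanSpace ℝ (Fin n) × EuclideanSpace ℝ (Fin n) in 𝓝 (x, x),
      q.1 ∈ U ∧ q.2 ∈ U :=
    (continuousAt_fst.eventually (h.isOpen.mem_nhds hxU)).and
      (continuousAt_snd.eventually (h.isOpen.mem_nhds hxU))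
  obtain ⟨δ, hδ, hball⟩ := Metric.eventually_nhds_iff_ball.1 (hlo.and hU)
  have hden : 0 < 1 + m + m := by positivity
  -- For `a = y - s e + v` with `|v| < m s / 4`, the linear part of `g a - g y` is at most `-(3/4)
  -- m² s`, and the error in strict differentiability is at most `(m/4)(5/4) m s`. The sum is
  -- negative. The radius keeps `a` and `y` inside the `δ`-ball.
  refine ⟨δ / (1 + m + m), m / 4, e, by positivity, by positivity, ?_⟩
  rintro y ⟨hyΩ, hyb⟩ s ⟨hs0, hs⟩ a ha
  set v := a - (y - s • e) with hv
  have hvn : ‖v‖ < m / 4 * s := by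
    rw [Metric.mem_ball, dist_eq_norm] at ha; exact ha
  have hay : a - y = v - s • e := by rw [hv]; abel
  have hse : ‖s • e‖ = s * m := by rw [norm_smul, Real.norm_of_nonneg hs0.le]
  have haynorm : ‖a - y‖ ≤ 5 / 4 * m * s := by
    rw [hay]; have := norm_sub_le v (s • e); rw [hse] at this; linarith
  have hs' : s * (1 + m + m) ≤ δ := by rwa [le_div_iff₀ hden] at hs
  have hyx : dist y x < δ / (1 + m + m) := hyb
  have hyx' : dist y x * (1 + m + m) < δ := by rwa [lt_div_iff₀ hden] at hyx
  have hry : dist y x < δ := by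
    have := @dist_nonneg _ _ y x
    nlinarith
  have hrad : dist a x < δ := by
    have h1 := dist_triangle a y x
    rw [dist_eq_norm a y] at h1
    have h2 : (δ / (1 + m + m)) * (1 + m + m) = δ := by field_simp
    nlinarith
  obtain ⟨hl, haU, hyU⟩ := hball (a, y) (by
    rw [Metric.mem_ball, Prod.dist_eq]; exact max_lt hrad hry)
  simp only at hl haU hyU
  refine h.mem_of_neg haU ?_
  have hgy := h.neg_of_mem hyU hyΩ
  have hd1 : fderiv ℝ g x (a - y) ≤ m * ‖v‖ - s * m ^ 2 := by
    have : fderiv ℝ g x (a - y) = inner ℝ e (a - y) := by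
      rw [he, inner_gradient_left]
    rw [this, hay, inner_sub_right, inner_smul_right, real_inner_self_eq_norm_sq]
    have := real_inner_le_norm e v
    linarith
  rw [Real.norm_eq_abs] at hl
  have h3 := (abs_le.1 hl).2
  have h4 : m * ‖v‖ ≤ m * (m / 4 * s) := by gcongr
  have h5 : m / 4 * ‖a - y‖ ≤ m / 4 * (5 / 4 * m * s) := by gcongr
  have h6 : 0 < m ^ 2 * s := by positivity
  nlinarith

end IsLocalDefiningFunction

theorem HasC1Boundary.exists_cone {n : ℕ} {Ω : Set (EuclideanSpace ℝ (Fin n))}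
    (h : HasC1Boundary Ω) {x : EuclideanSpace ℝ (Fin n)} (hx : x ∈ frontier Ω) :
    ∃ (r κ : ℝ) (e : EuclideanSpace ℝ (Fin n)), 0 < r ∧ 0 < κ ∧
      ∀ y ∈ Ω ∩ Metric.ball x r, ∀ s ∈ Ioc 0 r, Metric.ball (y - s • e) (κ * s) ⊆ Ω := by
  obtain ⟨U, g, hxU, hg⟩ := h x hx
  exact hg.exists_cone hxU

/-! ### Oscillation of functions with bounded gradient -/

/-- `u` is differentiable in `S` with gradient bounded by `M`. -/
def HasGradientBound {n : ℕ} (S : Set (EuclideanSpace ℝ (Fin n))) (M : ℝ)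
    (u : EuclideanSpace ℝ (Fin n) → ℝ) : Prop :=
  ∀ x ∈ S, DifferentiableAt ℝ u x ∧ ‖fderiv ℝ u x‖ ≤ M

theorem HasGradientBound.abs_sub_le {n : ℕ} {S C : Set (EuclideanSpace ℝ (Fin n))} {M : ℝ}
    {u : EuclideanSpace ℝ (Fin n) → ℝ} (hu : HasGradientBound S M u) (hC : Convex ℝ C)
    (hCS : C ⊆ S) {x y : EuclideanSpace ℝ (Fin n)} (hx : x ∈ C) (hy : y ∈ C) :
    |u x - u y| ≤ M * ‖x - y‖ := by
  have := hC.norm_image_sub_le_of_norm_fderiv_le (𝕜 := ℝ) (f := u)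
    (fun z hz => (hu z (hCS hz)).1) (fun z hz => (hu z (hCS hz)).2) hy hx
  simpa using this

/-- Near every point of the closure, functions with bounded gradient have bounded oscillation. -/
theorem HasC1Boundary.exists_local_osc_bound {n : ℕ} {S : Set (EuclideanSpace ℝ (Fin n))}
    (hS : HasC1Boundary S) (hSo : IsOpen S) (M : ℝ) {x : EuclideanSpace ℝ (Fin n)}
    (hx : x ∈ closure S) :
    ∃ V ∈ 𝓝 x, ∃ b ∈ S, ∃ K : ℝ, ∀ u, HasGradientBound S M u → ∀ z ∈ V ∩ S, |u z - u b| ≤ K := by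
  by_cases hxS : x ∈ S
  · obtain ⟨r, hr, hb⟩ := Metric.isOpen_iff.1 hSo x hxS
    refine ⟨Metric.ball x r, Metric.ball_mem_nhds x hr, x, hxS, |M| * r, fun u hu z hz => ?_⟩
    refine (hu.abs_sub_le (convex_ball x r) hb hz.1 (Metric.mem_ball_self hr)).trans ?_
    have h1 : ‖z - x‖ ≤ r := by rw [← dist_eq_norm]; exact (Metric.mem_ball.1 hz.1).le
    exact mul_le_mul (le_abs_self M) h1 (norm_nonneg _) (abs_nonneg _)
  · have hxf : x ∈ frontier S := by rw [hSo.frontier_eq]; exact ⟨hx, hxS⟩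
    obtain ⟨r, κ, e, hr, hκ, hcone⟩ := hS.exists_cone hxf
    set ρ := min r (κ * r) with hρ
    have hρpos : 0 < ρ := lt_min hr (by positivity)
    have hrr : r ∈ Ioc 0 r := ⟨hr, le_rfl⟩
    have hmem : ∀ z ∈ Metric.ball x ρ ∩ S, x - r • e ∈ Metric.ball (z - r • e) (κ * r) := by
      intro z hz
      rw [Metric.mem_ball, dist_sub_right, dist_comm]
      exact lt_of_lt_of_le hz.1 (min_le_right _ _)
    have hin : ∀ z ∈ Metric.ball x ρ ∩ S, z ∈ S ∩ Metric.ball x r := fun z hz =>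
      ⟨hz.2, Metric.ball_subset_ball (min_le_left _ _) hz.1⟩
    obtain ⟨z0, hz0⟩ := mem_closure_iff_nhds.1 hx _ (Metric.ball_mem_nhds x hρpos)
    -- Every `z` near `x` is joined to the common base point `x - r e` by a path of bounded length
    -- in `S`: the axis of its cone down to `z - r e`, then a segment inside the ball at the end of
    -- the cone.
    refine ⟨Metric.ball x ρ, Metric.ball_mem_nhds x hρpos, x - r • e,
      hcone z0 (hin z0 hz0) r hrr (hmem z0 hz0), |M| * (r * ‖e‖) + |M| * ρ, fun u hu z hz => ?_⟩
    have hseg : segment ℝ z (z - r • e) ⊆ S := by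
      rw [segment_eq_image']
      rintro _ ⟨t, ht, rfl⟩
      rcases ht.1.eq_or_lt with h0 | h0
      · simpa [← h0] using hz.2
      · have h1 : t * r ∈ Ioc 0 r := ⟨by positivity, by nlinarith [ht.2]⟩
        have h2 := hcone z (hin z hz) (t * r) h1
          (Metric.mem_ball_self (mul_pos hκ h1.1))
        convert! h2 using 1
        rw [mul_smul]; simp [sub_eq_add_neg]
    have h1 := hu.abs_sub_le (convex_segment _ _) hseg (left_mem_segment ℝ _ _)
      (right_mem_segment ℝ _ _)
    have h2 := hu.abs_sub_le (convex_ball _ _) (hcone z (hin z hz) r hrr)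
      (Metric.mem_ball_self (by positivity)) (hmem z hz)
    have h3 : ‖z - (z - r • e)‖ = r * ‖e‖ := by
      rw [sub_sub_cancel, norm_smul, Real.norm_of_nonneg hr.le]
    have h4 : ‖z - r • e - (x - r • e)‖ ≤ ρ := by
      rw [sub_sub_sub_cancel_right, ← dist_eq_norm]; exact (Metric.mem_ball.1 hz.1).le
    have h5 : M * (r * ‖e‖) ≤ |M| * (r * ‖e‖) :=
      mul_le_mul_of_nonneg_right (le_abs_self M) (by positivity)
    have h6 : M * ‖z - r • e - (x - r • e)‖ ≤ |M| * ρ :=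
      mul_le_mul (le_abs_self M) h4 (norm_nonneg _) (abs_nonneg _)
    rw [h3] at h1
    have h7 := abs_sub_le (u z) (u (z - r • e)) (u (x - r • e))
    linarith

/-- The bound is chosen before `u`, so it applies to all cross sections of the cylinder at once.
Connectedness links any two points of `S` by a finite constant, and compactness of the closure makes
the constant uniform. -/
theorem HasC1Boundary.exists_osc_bound {n : ℕ} {S : Set (EuclideanSpace ℝ (Fin n))}
    (hS : HasC1Boundary S) (hSo : IsOpen S) (hSb : Bornology.IsBounded S)
    (hSc : IsPreconnected S) (M : ℝ) :
    ∃ K : ℝ, ∀ u, HasGradientBound S M u → ∀ x ∈ S, ∀ y ∈ S, |u x - u y| ≤ K := by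
  have hpair : ∀ x ∈ S, ∀ y ∈ S, ∃ K : ℝ, ∀ u, HasGradientBound S M u → |u x - u y| ≤ K := by
    intro x hx y hy
    refine hSc.induction₂ (fun x y => ∃ K : ℝ, ∀ u, HasGradientBound S M u → |u x - u y| ≤ K)
      ?_ ?_ ?_ hx hy
    · intro x hx
      obtain ⟨V, hV, b, -, K, hK⟩ := hS.exists_local_osc_bound hSo M (subset_closure hx)
      filter_upwards [mem_nhdsWithin_of_mem_nhds hV, self_mem_nhdsWithin] with y hy hyS
      refine ⟨K + K, fun u hu => ?_⟩
      have h1 := hK u hu x ⟨mem_of_mem_nhds hV, hx⟩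
      have h2 := hK u hu y ⟨hy, hyS⟩
      have h3 := abs_sub_le (u x) (u b) (u y)
      rw [abs_sub_comm (u b)] at h3
      linarith
    · rintro x y z - - - ⟨K, hK⟩ ⟨K', hK'⟩
      exact ⟨K + K', fun u hu => (abs_sub_le _ (u y) _).trans (add_le_add (hK u hu) (hK' u hu))⟩
    · rintro x y - - ⟨K, hK⟩
      exact ⟨K, fun u hu => by rw [abs_sub_comm]; exact hK u hu⟩
  rcases S.eq_empty_or_nonempty with rfl | ⟨a, ha⟩
  · exact ⟨0, fun u _ x hx => hx.elim⟩
  have hcpt : IsCompact (closure S) := hSb.isCompact_closure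
  obtain ⟨K, hK⟩ := hcpt.induction_on
    (p := fun s => ∃ K : ℝ, ∀ u, HasGradientBound S M u → ∀ z ∈ s ∩ S, |u z - u a| ≤ K)
    ⟨0, fun u _ z hz => hz.1.elim⟩
    (fun s t hst ⟨K, hK⟩ => ⟨K, fun u hu z hz => hK u hu z ⟨hst hz.1, hz.2⟩⟩)
    (fun s t ⟨K, hK⟩ ⟨K', hK'⟩ => ⟨max K K', fun u hu z hz => hz.1.elim
      (fun h => (hK u hu z ⟨h, hz.2⟩).trans (le_max_left _ _))
      (fun h => (hK' u hu z ⟨h, hz.2⟩).trans (le_max_right _ _))⟩)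
    (fun x hx => by
      obtain ⟨V, hV, b, hb, K, hK⟩ := hS.exists_local_osc_bound hSo M hx
      obtain ⟨K', hK'⟩ := hpair b hb a ha
      exact ⟨V, mem_nhdsWithin_of_mem_nhds hV, K + K', fun u hu z hz =>
        (abs_sub_le _ (u b) _).trans (add_le_add (hK u hu z hz) (hK' u hu))⟩)
  refine ⟨K + K, fun u hu x hx y hy => ?_⟩
  have h1 := hK u hu x ⟨subset_closure hx, hx⟩
  have h2 := hK u hu y ⟨subset_closure hy, hy⟩
  have h3 := abs_sub_le (u x) (u a) (u y)
  rw [abs_sub_comm (u a)] at h3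
  linarith

/-! ### The distance to the complement -/

/-- The volume of a boundary strip is at most proportional to its width. -/
theorem HasC1Boundary.exists_strip_bound {n : ℕ} {Ω : Set (EuclideanSpace ℝ (Fin n))}
    (hΩ : HasC1Boundary Ω) (hΩo : IsOpen Ω) (hΩc : Ωᶜ.Nonempty)
    {K : Set (EuclideanSpace ℝ (Fin n))} (hK : IsCompact K) :
    ∃ C : ℝ≥0, ∀ ε : ℝ≥0, 0 < ε →
      volume (K ∩ {x ∈ Ω | Metric.infDist x Ωᶜ < ε}) ≤ C * ε := by
  refine hK.induction_on (p := fun K => ∃ C : ℝ≥0, ∀ ε : ℝ≥0, 0 < ε →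
      volume (K ∩ {x ∈ Ω | Metric.infDist x Ωᶜ < ε}) ≤ C * ε) ?_ ?_ ?_ ?_
  · exact ⟨0, by simp⟩
  · rintro s t hst ⟨C, hC⟩
    exact ⟨C, fun ε hε => (measure_mono (inter_subset_inter_left _ hst)).trans (hC ε hε)⟩
  · rintro s t ⟨C, hC⟩ ⟨D, hD⟩
    refine ⟨C + D, fun ε hε => ?_⟩
    rw [union_inter_distrib_right, ENNReal.coe_add, add_mul]
    exact (measure_union_le _ _).trans (add_le_add (hC ε hε) (hD ε hε))
  · intro x _
    suffices ∃ t ∈ 𝓝 x, ∃ C : ℝ≥0, ∀ ε : ℝ≥0, 0 < ε →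
        volume (t ∩ {x ∈ Ω | Metric.infDist x Ωᶜ < ε}) ≤ C * ε by
      obtain ⟨t, ht, h⟩ := this
      exact ⟨t, mem_nhdsWithin_of_mem_nhds ht, h⟩
    by_cases hcl : x ∈ closure Ω
    swap
    · refine ⟨(closure Ω)ᶜ, isClosed_closure.isOpen_compl.mem_nhds hcl, 0, fun ε hε => ?_⟩
      have : (closure Ω)ᶜ ∩ {x ∈ Ω | Metric.infDist x Ωᶜ < ε} = ∅ := by
        ext y
        simp only [mem_inter_iff, mem_compl_iff, mem_ofPred_eq, mem_empty_iff_false, iff_false]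
        rintro ⟨h1, h2, -⟩
        exact h1 (subset_closure h2)
      rw [this]; simp
    -- in all remaining cases it suffices to treat small `ε`
    suffices ∃ t ∈ 𝓝 x, volume t ≠ ⊤ ∧ ∃ (C ε₀ : ℝ≥0), 0 < ε₀ ∧ ∀ ε : ℝ≥0, 0 < ε → ε ≤ ε₀ →
        volume (t ∩ {x ∈ Ω | Metric.infDist x Ωᶜ < ε}) ≤ C * ε by
      obtain ⟨t, ht, htop, C, ε₀, hε₀, h⟩ := this
      refine ⟨t, ht, max C ((volume t).toNNReal / ε₀), fun ε hε => ?_⟩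
      rcases le_total ε ε₀ with hle | hle
      · refine (h ε hε hle).trans ?_
        gcongr
        exact_mod_cast le_max_left _ _
      · refine (measure_mono inter_subset_left).trans ?_
        rw [← ENNReal.coe_toNNReal htop]
        rw [← ENNReal.coe_mul, ENNReal.coe_le_coe]
        calc (volume t).toNNReal = (volume t).toNNReal / ε₀ * ε₀ := by
              rw [div_mul_cancel₀ _ hε₀.ne']
          _ ≤ _ := by
              gcongr
              rw [ENNReal.coe_toNNReal htop]
              exact le_max_right _ _
    by_cases hxΩ : x ∈ Ω
    · have hpos : 0 < Metric.infDist x Ωᶜ :=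
        (hΩo.isClosed_compl.notMem_iff_infDist_pos hΩc).1 (by simpa using hxΩ)
      refine ⟨Metric.ball x (Metric.infDist x Ωᶜ / 2), Metric.ball_mem_nhds _ (by positivity),
        measure_ball_lt_top.ne, 0, (Metric.infDist x Ωᶜ / 2).toNNReal,
        Real.toNNReal_pos.2 (half_pos hpos), fun ε _ hε => ?_⟩
      have : Metric.ball x (Metric.infDist x Ωᶜ / 2) ∩ {x ∈ Ω | Metric.infDist x Ωᶜ < ε} = ∅ := by
        ext y
        simp only [mem_inter_iff, Metric.mem_ball, mem_ofPred_eq, mem_empty_iff_false, iff_false]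
        rintro ⟨h1, -, h2⟩
        have h3 := Metric.infDist_le_infDist_add_dist (s := Ωᶜ) (x := x) (y := y)
        have h4 : (ε : ℝ) ≤ Metric.infDist x Ωᶜ / 2 :=
          (NNReal.coe_le_coe.2 hε).trans_eq (Real.coe_toNNReal _ (half_pos hpos).le)
        rw [dist_comm] at h3
        linarith
      rw [this]; simp
    · have hxf : x ∈ frontier Ω := by rw [hΩo.frontier_eq]; exact ⟨hcl, hxΩ⟩
      obtain ⟨r, κ, e, hr, hκ, hcone⟩ := hΩ.exists_cone hxf
      set W := Metric.ball x (r + r * ‖e‖) with hW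
      have hWtop : volume W ≠ ⊤ := measure_ball_lt_top.ne
      refine ⟨Metric.ball x r, Metric.ball_mem_nhds x hr, measure_ball_lt_top.ne,
        (volume W).toNNReal * (2 / (κ * r).toNNReal), (κ * r).toNNReal,
        Real.toNNReal_pos.2 (by positivity), fun ε hε hεr => ?_⟩
      set N := Metric.ball x r ∩ {x ∈ Ω | Metric.infDist x Ωᶜ < ε} with hN
      have hNm : MeasurableSet N := by
        refine Metric.isOpen_ball.measurableSet.inter (hΩo.measurableSet.inter ?_)
        exact measurableSet_lt (Metric.continuous_infDist_pt _).measurable measurable_const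
      have hεr' : (ε : ℝ) ≤ κ * r := by
        rwa [← NNReal.coe_le_coe, Real.coe_toNNReal _ (by positivity)] at hεr
      have hεpos : (0 : ℝ) < ε := hε
      -- Moving inwards by `h e` from a point of `Ω` near `x` produces distance at least `κ h = ε`
      -- from the complement, so it leaves the strip. The shifts of the strip by multiples of `h e`
      -- are therefore disjoint. About `r / h` of them fit into the fixed ball `W`, so the strip has
      -- volume at most of order `h`.
      set h := (ε : ℝ) / κ with hh
      have hhpos : 0 < h := by positivity
      set J := ⌊r / h⌋₊ with hJ
      have hrh : 1 ≤ r / h := by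
        rw [hh, one_le_div hhpos, div_le_iff₀ hκ]; linarith
      have hJge : r / h ≤ 2 * J := by
        have h1 := Nat.lt_floor_add_one (r / h)
        have h2 : (1 : ℝ) ≤ J := by exact_mod_cast Nat.one_le_floor_iff _ |>.2 hrh
        linarith
      have hJle : (J : ℝ) * h ≤ r := by
        have := Nat.floor_le (show 0 ≤ r / h by positivity)
        rwa [le_div_iff₀ hhpos] at this
      -- translates of the strip
      set T : ℕ → Set (EuclideanSpace ℝ (Fin n)) := fun j => (fun y => y + ((j : ℝ) * h) • e) ⁻¹' N
        with hT
      have hTvol : ∀ j, volume (T j) = volume N := fun j => measure_preimage_add_right _ _ _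
      have hTm : ∀ j, MeasurableSet (T j) := fun j => (measurable_add_const _) hNm
      have hlt : ∀ i j : ℕ, i < j → j < J → Disjoint (T i) (T j) := by
        intro i j hij hjJ
        rw [Set.disjoint_left]
        intro z hzi hzj
        have hs : ((j : ℝ) - i) * h ∈ Ioc 0 r := by
          have h1 : (i : ℝ) + 1 ≤ j := by exact_mod_cast hij
          have h2 : (j : ℝ) ≤ J := by exact_mod_cast hjJ.le
          have h3 : (0 : ℝ) ≤ i := Nat.cast_nonneg i
          exact ⟨by nlinarith, by nlinarith⟩
        have h1 := hcone _ ⟨hzj.2.1, hzj.1⟩ _ hs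
        have h2 : z + ((j : ℝ) * h) • e - (((j : ℝ) - i) * h) • e = z + ((i : ℝ) * h) • e := by
          rw [add_sub_assoc, ← sub_smul]; congr 2; ring
        rw [h2] at h1
        have h3 : κ * (((j : ℝ) - i) * h) ≤ Metric.infDist (z + ((i : ℝ) * h) • e) Ωᶜ := by
          by_contra! hcon
          obtain ⟨y, hy, hyd⟩ := (Metric.infDist_lt_iff hΩc).1 hcon
          exact hy (h1 (by rwa [Metric.mem_ball, dist_comm]))
        have h4 := hzi.2.2
        have h5 : κ * h = ε := by rw [hh]; field_simp
        have h6 : (i : ℝ) + 1 ≤ j := by exact_mod_cast hij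
        have h7 : (ε : ℝ) ≤ κ * (((j : ℝ) - i) * h) := by
          rw [← h5]
          have : h ≤ ((j : ℝ) - i) * h := by nlinarith
          gcongr
        exact absurd h4 (not_lt.2 (h7.trans h3))
      have hdisj : ((Finset.range J : Finset ℕ) : Set ℕ).PairwiseDisjoint T := by
        intro i hi j hj hij
        simp only [Finset.coe_range, mem_Iio] at hi hj
        rcases lt_or_gt_of_ne hij with h1 | h1
        · exact hlt i j h1 hj
        · exact (hlt j i h1 hi).symm
      have hsub : (⋃ j ∈ Finset.range J, T j) ⊆ W := by
        intro z hz
        simp only [mem_iUnion, Finset.mem_range] at hz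
        obtain ⟨j, hj, hz⟩ := hz
        have h1 : dist (z + ((j : ℝ) * h) • e) x < r := hz.1
        have h2 : dist z (z + ((j : ℝ) * h) • e) ≤ r * ‖e‖ := by
          rw [dist_self_add_right, norm_smul, Real.norm_of_nonneg (by positivity)]
          have : (j : ℝ) ≤ J := by exact_mod_cast hj.le
          gcongr
          nlinarith
        rw [hW, Metric.mem_ball]
        have := dist_triangle z (z + ((j : ℝ) * h) • e) x
        linarith
      have hsum : (J : ENNReal) * volume N ≤ volume W := by
        have h1 := measure_biUnion_finset (μ := volume) hdisj fun j _ => hTm j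
        simp only [hTvol, Finset.sum_const, Finset.card_range, nsmul_eq_mul] at h1
        rw [← h1]
        exact measure_mono hsub
      have hNtop : volume N ≠ ⊤ :=
        ((measure_mono inter_subset_left).trans_lt measure_ball_lt_top).ne
      rw [← ENNReal.coe_toNNReal hNtop, ← ENNReal.coe_toNNReal hWtop] at hsum
      rw [← ENNReal.coe_toNNReal hNtop, ← ENNReal.coe_mul, ENNReal.coe_le_coe, ← NNReal.coe_le_coe]
      have hsum' : (J : ℝ) * (volume N).toNNReal ≤ (volume W).toNNReal := by exact_mod_cast hsum
      push_cast
      rw [Real.coe_toNNReal _ (by positivity)]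
      have h8 : (r / h) * (volume N).toNNReal ≤ 2 * (volume W).toNNReal := by
        have : (0 : ℝ) ≤ (volume N).toNNReal := NNReal.coe_nonneg _
        nlinarith
      have h9 : r / h = κ * r / ε := by rw [hh]; field_simp
      rw [h9, div_mul_eq_mul_div, div_le_iff₀ hεpos] at h8
      simp only [ENNReal.coe_toNNReal_eq_toReal] at h8 ⊢
      rw [mul_div_assoc', div_mul_eq_mul_div, le_div_iff₀ (by positivity)]
      linarith

/-! ### The divergence theorem for fields tangential to the boundary -/

/-- Where the distance to the complement is differentiable, its gradient is a multiple of the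
normal at a nearest boundary point. -/
theorem HasC1Boundary.exists_normal_of_differentiableAt_infDist {n : ℕ}
    {Ω : Set (EuclideanSpace ℝ (Fin n))} (hΩ : HasC1Boundary Ω) (hΩo : IsOpen Ω)
    (hΩc : Ωᶜ.Nonempty) {x : EuclideanSpace ℝ (Fin n)} (hx : x ∈ Ω)
    (hd : DifferentiableAt ℝ (fun z => Metric.infDist z Ωᶜ) x) :
    ∃ y ∈ frontier Ω, ∃ e ν : EuclideanSpace ℝ (Fin n), dist x y = Metric.infDist x Ωᶜ ∧ ‖e‖ = 1 ∧
      (∀ v, fderiv ℝ (fun z => Metric.infDist z Ωᶜ) x v = inner ℝ e v) ∧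
      IsOuterUnitNormal Ω y ν ∧ ∃ c : ℝ, e = c • ν := by
  obtain ⟨y, hyc, hyd⟩ := hΩo.isClosed_compl.exists_infDist_eq_dist hΩc x
  have hpos : 0 < Metric.infDist x Ωᶜ :=
    (hΩo.isClosed_compl.notMem_iff_infDist_pos hΩc).1 (by simpa using hx)
  set R := Metric.infDist x Ωᶜ with hR
  have hball : Metric.ball x R ⊆ Ω := by
    intro z hz
    by_contra hcon
    have := Metric.infDist_le_dist_of_mem (x := x) (show z ∈ Ωᶜ from hcon)
    rw [Metric.mem_ball, dist_comm] at hz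
    linarith
  have hnorm : ‖x - y‖ = R := by rw [← dist_eq_norm, hyd]
  have hyf : y ∈ frontier Ω := by
    rw [hΩo.frontier_eq]
    refine ⟨closure_mono hball ?_, hyc⟩
    rw [closure_ball x hpos.ne', Metric.mem_closedBall, dist_comm, hyd]
  obtain ⟨U, g, hyU, hg⟩ := hΩ y hyf
  set a := x - y with ha
  set b := gradient g y with hb
  have hbpos : 0 < ‖b‖ := norm_pos_iff.2 (hg.gradient_ne_zero y hyU)
  -- the ball touches the boundary from inside
  have hdir : ∀ v, 0 < inner ℝ a v → inner ℝ b v ≤ 0 := by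
    intro v hv
    have hline : HasDerivAt (fun s : ℝ => g (y + s • v)) (inner ℝ b v) 0 := by
      have h1 : HasFDerivAt g (fderiv ℝ g y) (y + (0 : ℝ) • v) := by
        simpa using (hg.differentiableAt hyU).hasFDerivAt
      have h2 : HasDerivAt (fun s : ℝ => y + s • v) v 0 := by
        simpa using ((hasDerivAt_id (0 : ℝ)).smul_const v).const_add y
      have := h1.comp_hasDerivAt (0 : ℝ) h2
      rw [hb, inner_gradient_left]
      exact this
    have hU : ∀ᶠ s : ℝ in 𝓝[>] 0, y + s • v ∈ U := by
      have hc : Continuous fun s : ℝ => y + s • v := by fun_prop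
      exact (hc.continuousAt (x := 0)).continuousWithinAt.eventually
        (hg.isOpen.mem_nhds (by simpa using hyU))
    have hsm : ∀ᶠ s : ℝ in 𝓝[>] 0, s * ‖v‖ ^ 2 < 2 * inner ℝ a v := by
      have hc : Continuous fun s : ℝ => s * ‖v‖ ^ 2 := by fun_prop
      exact (hc.continuousAt (x := 0)).continuousWithinAt.eventually
        (Iio_mem_nhds (by simpa using hv))
    have hslope := hasDerivWithinAt_iff_tendsto_slope.1 (hline.hasDerivWithinAt (s := Ioi 0))
    rw [show Ioi (0 : ℝ) \ {0} = Ioi 0 by simp] at hslope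
    refine le_of_tendsto hslope ?_
    filter_upwards [hU, hsm, self_mem_nhdsWithin] with s hs1 hs2 hs3
    have hs3 : (0 : ℝ) < s := hs3
    have hin : y + s • v ∈ Ω := by
      apply hball
      rw [Metric.mem_ball, dist_eq_norm, ← hnorm]
      refine lt_of_pow_lt_pow_left₀ 2 (norm_nonneg _) ?_
      have : y + s • v - x = s • v - a := by rw [ha]; abel
      rw [this, norm_sub_sq_real, norm_smul, inner_smul_left, real_inner_comm, mul_pow]
      simp only [Real.norm_eq_abs, sq_abs, conj_trivial]
      nlinarith
    have h1 := hg.neg_of_mem hs1 hin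
    have h2 := hg.nonneg_of_notMem hyU hyc
    rw [slope_def_field]
    simp only [zero_smul, add_zero, sub_zero]
    exact div_nonpos_of_nonpos_of_nonneg (by linarith) hs3.le
  -- The part of `a` orthogonal to `b`; it has to vanish.
  set w := a - (inner ℝ a b / ‖b‖ ^ 2) • b with hw
  have hwb : inner ℝ w b = 0 := by
    rw [hw, inner_sub_left, inner_smul_left, real_inner_self_eq_norm_sq]
    simp only [conj_trivial]
    field_simp
    ring
  have hwa : inner ℝ a w = ‖w‖ ^ 2 := by
    have : a = w + (inner ℝ a b / ‖b‖ ^ 2) • b := by rw [hw]; abel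
    nth_rewrite 1 [this]
    rw [inner_add_left, inner_smul_left, real_inner_comm w b, hwb, real_inner_self_eq_norm_sq]
    simp
  have hw0 : w = 0 := by
    by_contra hne
    have hwpos : 0 < ‖w‖ ^ 2 := by
      have := norm_pos_iff.2 hne
      positivity
    -- If `w ≠ 0`, tilting `w` slightly towards `b` gives a direction that still enters the ball but
    -- along which `g` increases. The `+ 1` keeps the denominator positive when `⟨a, b⟩ = 0`.
    set δ := ‖w‖ ^ 2 / (2 * (|inner ℝ a b| + 1)) with hδ
    have hden : 0 < |inner ℝ a b| + 1 := by positivity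
    have hδpos : 0 < δ := by positivity
    have hδeq : δ * (|inner ℝ a b| + 1) = ‖w‖ ^ 2 / 2 := by rw [hδ]; field_simp
    have h1 := hdir (w + δ • b) (by
      rw [inner_add_right, inner_smul_right, hwa]
      have := neg_abs_le (inner ℝ a b)
      nlinarith)
    rw [inner_add_right, inner_smul_right, real_inner_comm w b, hwb,
      real_inner_self_eq_norm_sq] at h1
    have : 0 < δ * ‖b‖ ^ 2 := by positivity
    linarith
  refine ⟨y, hyf, R⁻¹ • a, ‖b‖⁻¹ • b, hyd.symm, ?_, ?_, ⟨U, g, hyU, hg, rfl⟩,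
    R⁻¹ * (inner ℝ a b / ‖b‖ ^ 2) * ‖b‖, ?_⟩
  · rw [norm_smul, norm_inv, Real.norm_of_nonneg hpos.le, hnorm, inv_mul_cancel₀ hpos.ne']
  · intro v
    -- The squared distance to `y` dominates the squared distance to the complement, with equality
    -- at `x`. Vanishing of the derivative of the difference gives `∇δ(x) = (x - y)/R` for the
    -- distance function `δ`.
    have h1 : HasFDerivAt (fun z => ‖z - y‖ ^ 2 - (Metric.infDist z Ωᶜ) ^ 2)
        (2 • (innerSL ℝ a) - (2 * R) • fderiv ℝ (fun z => Metric.infDist z Ωᶜ) x) x := by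
      refine HasFDerivAt.sub ?_ ?_
      · have := ((hasFDerivAt_id x).sub_const y).norm_sq
        convert! this using 1
      · have := hd.hasFDerivAt.pow 2
        convert! this using 1
        simp [hR]
    have h2 : IsLocalMin (fun z => ‖z - y‖ ^ 2 - (Metric.infDist z Ωᶜ) ^ 2) x := by
      refine Filter.Eventually.of_forall fun z => ?_
      have h3 := Metric.infDist_le_dist_of_mem (x := z) hyc
      rw [dist_eq_norm] at h3
      have h4 : 0 ≤ Metric.infDist z Ωᶜ := Metric.infDist_nonneg
      simp only [← ha, hnorm, ← hR]
      nlinarith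
    have h3 := congrArg (fun L => L v) (h2.hasFDerivAt_eq_zero h1)
    simp at h3
    rw [inner_smul_left]
    simp only [conj_trivial]
    field_simp
    linarith
  · have : a = (inner ℝ a b / ‖b‖ ^ 2) • b := by
      rw [← sub_eq_zero]; exact hw0
    rw [smul_smul, mul_assoc, mul_inv_cancel₀ hbpos.ne', mul_one, mul_smul, ← this]

/-! ### Lipschitz test functions and interior integration by parts -/

/-- Replaces the chain rule for a piecewise linear function of the distance, whose kinks would
otherwise need separate treatment: difference quotients in direction `v` are compared and passed to
the limit. -/
theorem abs_fderiv_le_of_abs_sub_le {E : Type*} [NormedAddCommGroup E] [NormedSpace ℝ E]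
    {f g : E → ℝ} {x : E} {k : ℝ} (hf : DifferentiableAt ℝ f x) (hg : DifferentiableAt ℝ g x)
    (h : ∀ z, |f z - f x| ≤ k * |g z - g x|) (v : E) :
    |fderiv ℝ f x v| ≤ k * |fderiv ℝ g x v| := by
  have key : ∀ {f : E → ℝ}, DifferentiableAt ℝ f x →
      Filter.Tendsto (fun t : ℝ => |t⁻¹ • (f (x + t • v) - f x)|) (𝓝[≠] 0)
        (𝓝 |fderiv ℝ f x v|) := fun hf =>
    (hf.hasFDerivAt.hasLineDerivAt v).tendsto_slope_zero.abs
  refine le_of_tendsto_of_tendsto' (key hf) ((key hg).const_mul k) fun t => ?_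
  simp only [smul_eq_mul, abs_mul]
  calc |t⁻¹| * |f (x + t • v) - f x| ≤ |t⁻¹| * (k * |g (x + t • v) - g x|) := by
        gcongr; exact h _
    _ = _ := by ring

theorem LipschitzWith.mul_of_bounded {X : Type*} [PseudoMetricSpace X] {f g : X → ℝ}
    {A B a b : ℝ≥0} (hf : LipschitzWith A f) (hg : LipschitzWith B g) (ha : ∀ x, |f x| ≤ a)
    (hb : ∀ x, |g x| ≤ b) : LipschitzWith (A * b + a * B) (fun x => f x * g x) := by
  refine LipschitzWith.of_dist_le_mul fun x y => ?_
  have h1 := hf.dist_le_mul x y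
  have h2 := hg.dist_le_mul x y
  rw [Real.dist_eq] at *
  have : f x * g x - f y * g y = (f x - f y) * g x + f y * (g x - g y) := by ring
  rw [this]
  refine (abs_add_le _ _).trans ?_
  rw [abs_mul, abs_mul]
  push_cast
  calc |f x - f y| * |g x| + |f y| * |g x - g y|
      ≤ (A * dist x y) * b + a * (B * dist x y) := by
        gcongr
        · exact hb x
        · exact ha y
    _ = _ := by ring

/-- A smooth cutoff function. -/
theorem exists_contDiff_cutoff {E : Type*} [NormedAddCommGroup E] [NormedSpace ℝ E]
    [FiniteDimensional ℝ E] {K Ω : Set E} (hK : IsCompact K) (hΩ : IsOpen Ω) (hKΩ : K ⊆ Ω) :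
    ∃ β : E → ℝ, ContDiff ℝ 1 β ∧ HasCompactSupport β ∧ tsupport β ⊆ Ω ∧ ∀ᶠ x in 𝓝ˢ K, β x = 1 := by
  obtain ⟨K', hK', hKK', hK'Ω⟩ := exists_compact_between hK hΩ hKΩ
  obtain ⟨f, hf1, hf0, -⟩ := exists_contMDiffMap_one_nhds_of_subset_interior
    (modelWithCornersSelf ℝ E) (n := 1) hK.isClosed hKK'
  have hsub : tsupport f ⊆ K' := by
    refine closure_minimal ?_ hK'.isClosed
    intro x hx
    by_contra hcon
    exact hx (hf0 x hcon)
  exact ⟨f, f.contMDiff.contDiff, HasCompactSupport.of_support_subset_isCompact hK'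
    (subset_closure.trans hsub), hsub.trans hK'Ω, hf1⟩

/-- Integration by parts against a Lipschitz function with compact support in `Ω`. -/
theorem integral_mul_divergence_of_tsupport_subset {n : ℕ} {Ω : Set (EuclideanSpace ℝ (Fin n))}
    (hΩ : IsOpen Ω) {H : EuclideanSpace ℝ (Fin n) → EuclideanSpace ℝ (Fin n)}
    (hH : ContDiffOn ℝ 1 H Ω) {ζ : EuclideanSpace ℝ (Fin n) → ℝ} {L : ℝ≥0}
    (hζ : LipschitzWith L ζ) (hζc : HasCompactSupport ζ) (hζΩ : tsupport ζ ⊆ Ω) :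
    ∫ x, ζ x * divergence H x = -∫ x, fderiv ℝ ζ x (H x) := by
  -- `H` is smooth only inside `Ω`. Near the support of `ζ` it agrees with `β H`, which is globally
  -- `C¹` with compact support.
  obtain ⟨β, hβ, hβc, hβΩ, hβ1⟩ := exists_contDiff_cutoff hζc.isCompact hΩ hζΩ
  set F : EuclideanSpace ℝ (Fin n) → EuclideanSpace ℝ (Fin n) := fun x => β x • H x with hF
  have hFs : tsupport F ⊆ tsupport β := closure_mono fun x hx hcon => hx (by
    simp only [hF]; rw [hcon, zero_smul])
  have hF1 : ContDiff ℝ 1 F := by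
    rw [contDiff_iff_contDiffAt]
    intro x
    by_cases hx : x ∈ tsupport β
    · exact hβ.contDiffAt.smul (hH.contDiffAt (hΩ.mem_nhds (hβΩ hx)))
    · refine (contDiffAt_const (c := (0 : EuclideanSpace ℝ (Fin n)))).congr_of_eventuallyEq ?_
      filter_upwards [(isClosed_tsupport β).isOpen_compl.mem_nhds hx] with y hy
      simp only [hF]
      rw [image_eq_zero_of_notMem_tsupport hy, zero_smul]
  have hFc : HasCompactSupport F :=
    HasCompactSupport.of_support_subset_isCompact hβc.isCompact (subset_closure.trans hFs)
  have hFi1 : ∀ i, ContDiff ℝ 1 (fun x => F x i) := fun i => by fun_prop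
  have hFic : ∀ i, HasCompactSupport (fun x => F x i) := fun i =>
    hFc.mono fun x hx hcon => hx (by simp only [hcon]; rfl)
  have hparts : ∀ i : Fin n, ∫ x, lineDeriv ℝ ζ x (EuclideanSpace.single i 1) * F x i =
      -∫ x, (fderiv ℝ F x (EuclideanSpace.single i 1)) i * ζ x := by
    intro i
    obtain ⟨D, hD⟩ := (hFi1 i).lipschitzWith_of_hasCompactSupport (hFic i) one_ne_zero
    rw [hζ.integral_lineDeriv_mul_eq hD (hFic i), ← integral_neg]
    congr 1
    ext x
    have hdiff : HasFDerivAt (fun x => F x i)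
        ((EuclideanSpace.proj i : EuclideanSpace ℝ (Fin n) →L[ℝ] ℝ).comp (fderiv ℝ F x)) x :=
      (EuclideanSpace.proj i : EuclideanSpace ℝ (Fin n) →L[ℝ] ℝ).hasFDerivAt.comp x
        (hF1.differentiable one_ne_zero x).hasFDerivAt
    rw [(hdiff.hasLineDerivAt _).lineDeriv]
    simp
  -- `ζ` vanishes away from the set where `F = H`
  have hnear : ∀ x ∈ tsupport ζ, F =ᶠ[𝓝 x] H := fun x hx => by
    filter_upwards [hβ1.filter_mono (nhds_le_nhdsSet hx)] with y hy
    simp only [hF]; rw [hy, one_smul]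
  have hdiv : ∀ x, ζ x * divergence H x =
      ∑ i, (fderiv ℝ F x (EuclideanSpace.single i 1)) i * ζ x := by
    intro x
    by_cases hx : x ∈ tsupport ζ
    · rw [divergence, ← Finset.sum_mul, mul_comm, (hnear x hx).fderiv_eq]
    · simp [image_eq_zero_of_notMem_tsupport hx]
  have hgrad : ∀ᵐ x, fderiv ℝ ζ x (H x) =
      ∑ i, lineDeriv ℝ ζ x (EuclideanSpace.single i 1) * F x i := by
    filter_upwards [hζ.ae_differentiableAt] with x hx
    by_cases hxs : x ∈ tsupport ζ
    · rw [← (hnear x hxs).eq_of_nhds]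
      simp only [hx.lineDeriv_eq_fderiv]
      conv_lhs => rw [← (EuclideanSpace.basisFun (Fin n) ℝ).sum_repr (F x)]
      rw [map_sum]
      refine Finset.sum_congr rfl fun i _ => ?_
      rw [map_smul, smul_eq_mul, mul_comm]
      simp
    · have h0 : fderiv ℝ ζ x = 0 := by
        have : ζ =ᶠ[𝓝 x] fun _ => 0 := by
          filter_upwards [(isClosed_tsupport ζ).isOpen_compl.mem_nhds hxs] with y hy
          exact image_eq_zero_of_notMem_tsupport hy
        rw [this.fderiv_eq]; simp
      simp [hx.lineDeriv_eq_fderiv, h0]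
  have hint1 : ∀ i, Integrable fun x => (fderiv ℝ F x (EuclideanSpace.single i 1)) i * ζ x := by
    intro i
    have hc : Continuous fun x => fderiv ℝ F x := hF1.continuous_fderiv one_ne_zero
    have hζcont := hζ.continuous
    exact Continuous.integrable_of_hasCompactSupport (by fun_prop) hζc.mul_left
  have hint2 : ∀ i, Integrable fun x =>
      lineDeriv ℝ ζ x (EuclideanSpace.single i 1) * F x i := by
    intro i
    have hi : Integrable fun x => F x i :=
      Continuous.integrable_of_hasCompactSupport (hFi1 i).continuous (hFic i)
    refine hi.bdd_mul (c := L * ‖EuclideanSpace.single i (1 : ℝ)‖) ?_ ?_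
    · exact (measurable_lineDeriv hζ.continuous).aestronglyMeasurable
    · exact Filter.Eventually.of_forall fun x => norm_lineDeriv_le_of_lipschitz ℝ hζ
  simp_rw [hdiv]
  rw [integral_finsetSum _ fun i _ => hint1 i, integral_congr_ae hgrad,
    integral_finsetSum _ fun i _ => hint2 i, ← Finset.sum_neg_distrib]
  refine Finset.sum_congr rfl fun i _ => ?_
  rw [hparts i, neg_neg]

/-- The piecewise linear function `0` for `s ≤ 0`, `s` for `0 ≤ s ≤ 1`, `1` for `1 ≤ s`. -/
def clampUnit (s : ℝ) : ℝ := max 0 (min 1 s)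

theorem lipschitzWith_clampUnit : LipschitzWith 1 clampUnit :=
  (LipschitzWith.id.const_min 1).const_max 0

theorem clampUnit_nonneg (s : ℝ) : 0 ≤ clampUnit s := le_max_left _ _

theorem clampUnit_le_one (s : ℝ) : clampUnit s ≤ 1 := max_le zero_le_one (min_le_left _ _)

theorem abs_clampUnit_le_one (s : ℝ) : |clampUnit s| ≤ 1 := by
  rw [abs_of_nonneg (clampUnit_nonneg s)]; exact clampUnit_le_one s

theorem clampUnit_of_one_le {s : ℝ} (h : 1 ≤ s) : clampUnit s = 1 := by
  rw [clampUnit, min_eq_left h, max_eq_right zero_le_one]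

theorem clampUnit_of_nonpos {s : ℝ} (h : s ≤ 0) : clampUnit s = 0 :=
  max_eq_left ((min_le_right _ _).trans h)

/-- The divergence theorem for a vector field that is tangential to the boundary. -/
theorem HasC1Boundary.integral_mul_divergence {n : ℕ} {Ω : Set (EuclideanSpace ℝ (Fin n))}
    (hΩ : HasC1Boundary Ω) (hΩo : IsOpen Ω) (hΩc : Ωᶜ.Nonempty)
    {H : EuclideanSpace ℝ (Fin n) → EuclideanSpace ℝ (Fin n)} (hH1 : ContDiffOn ℝ 1 H Ω)
    (hHc : ContinuousOn H (closure Ω))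
    (hHν : ∀ x ∈ frontier Ω, ∀ ν, IsOuterUnitNormal Ω x ν → inner ℝ (H x) ν = 0)
    {ψ : EuclideanSpace ℝ (Fin n) → ℝ} {L : ℝ≥0} (hψ : LipschitzWith L ψ)
    (hψc : HasCompactSupport ψ) (hint : IntegrableOn (fun x => ψ x * divergence H x) Ω) :
    ∫ x in Ω, ψ x * divergence H x = -∫ x in Ω, fderiv ℝ ψ x (H x) := by
  set δ : EuclideanSpace ℝ (Fin n) → ℝ := fun z => Metric.infDist z Ωᶜ with hδ
  have hδL : LipschitzWith 1 δ := Metric.lipschitz_infDist_pt _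
  have hδpos : ∀ x ∈ Ω, 0 < δ x := fun x hx =>
    (hΩo.isClosed_compl.notMem_iff_infDist_pos hΩc).1 (by simpa using hx)
  have hδout : ∀ x, x ∉ Ω → δ x = 0 := fun x hx => Metric.infDist_zero_of_mem hx
  obtain ⟨a, ha⟩ : ∃ a : ℝ≥0, ∀ x, |ψ x| ≤ a := by
    obtain ⟨C, hC⟩ := hψc.exists_bound_of_continuous hψ.continuous
    exact ⟨C.toNNReal, fun x => (hC x).trans (Real.le_coe_toNNReal C)⟩
  -- cutoffs
  set N : ℕ → ℝ≥0 := fun k => (k : ℝ≥0) + 1 with hN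
  have hNpos : ∀ k, (0 : ℝ) < N k := fun k => by simp only [hN]; positivity
  -- Zero where `N δ ≤ 1` and one where `N δ ≥ 2`; the offset `-1` keeps the support away from the
  -- boundary.
  set χ : ℕ → EuclideanSpace ℝ (Fin n) → ℝ := fun k x => clampUnit (N k * δ x - 1) with hχ
  have hχdiff : ∀ k x z, |χ k z - χ k x| ≤ N k * |δ z - δ x| := by
    intro k x z
    have h1 := lipschitzWith_clampUnit.dist_le_mul (N k * δ z - 1) (N k * δ x - 1)
    rw [Real.dist_eq, Real.dist_eq, NNReal.coe_one, one_mul, sub_sub_sub_cancel_right, ← mul_sub,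
      abs_mul, abs_of_pos (hNpos k)] at h1
    exact h1
  have hχL : ∀ k, LipschitzWith (N k) (χ k) := fun k =>
    LipschitzWith.of_dist_le_mul fun x y => by
      rw [Real.dist_eq]
      refine (hχdiff k y x).trans ?_
      have := hδL.dist_le_mul x y
      rw [Real.dist_eq, NNReal.coe_one, one_mul] at this
      gcongr
  have hχ1 : ∀ k x, |χ k x| ≤ (1 : ℝ≥0) := fun k x => abs_clampUnit_le_one _
  have hχlim : ∀ x ∈ Ω, ∀ᶠ k in Filter.atTop, χ k x = 1 := by
    intro x hx
    obtain ⟨k0, hk0⟩ := exists_nat_gt (2 / δ x)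
    filter_upwards [Filter.eventually_ge_atTop k0] with k hk
    apply clampUnit_of_one_le
    have h1 : (k0 : ℝ) ≤ k := by exact_mod_cast hk
    have h2 := hδpos x hx
    rw [div_lt_iff₀ h2] at hk0
    have h3 : (N k : ℝ) = k + 1 := by simp [hN]
    rw [h3]
    nlinarith
  have hζL : ∀ k, LipschitzWith (L * 1 + a * N k) fun x => ψ x * χ k x := fun k =>
    hψ.mul_of_bounded (hχL k) ha (hχ1 k)
  have hζsub : ∀ k, tsupport (fun x => ψ x * χ k x) ⊆ Ω := by
    intro k
    have h1 : tsupport (fun x => ψ x * χ k x) ⊆ {x | 1 ≤ N k * δ x} := by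
      refine closure_minimal ?_ (isClosed_le continuous_const
        (continuous_const.mul hδL.continuous))
      intro x hx
      by_contra hcon
      apply hx
      have : χ k x = 0 := clampUnit_of_nonpos (by
        have : N k * δ x < 1 := not_le.1 hcon
        linarith)
      simp only [this, mul_zero]
    intro x hx
    by_contra hcon
    have h2 : 1 ≤ N k * δ x := h1 hx
    rw [hδout x hcon] at h2
    norm_num at h2
  have hζc : ∀ k, HasCompactSupport fun x => ψ x * χ k x := fun k => hψc.mul_right
  have hIBP : ∀ k, ∫ x in Ω, χ k x * (ψ x * divergence H x) =
      -∫ x in Ω, fderiv ℝ (fun x => ψ x * χ k x) x (H x) := by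
    intro k
    have h := integral_mul_divergence_of_tsupport_subset hΩo hH1 (hζL k) (hζc k) (hζsub k)
    rw [setIntegral_eq_integral_of_forall_compl_eq_zero,
      setIntegral_eq_integral_of_forall_compl_eq_zero, ← h]
    · congr 1; ext x; ring
    · intro x hx
      have : fderiv ℝ (fun x => ψ x * χ k x) x = 0 := by
        by_contra hne
        exact hx (hζsub k (support_fderiv_subset ℝ hne))
      rw [this]; rfl
    · intro x hx
      have := image_eq_zero_of_notMem_tsupport (fun h => hx (hζsub k h))
      rw [← mul_assoc, mul_comm (χ k x), this, zero_mul]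
  -- integrability
  set Kc := closure Ω ∩ Metric.cthickening 1 (tsupport ψ) with hKc
  have hKcpt : IsCompact Kc := (hψc.isCompact.cthickening).inter_left isClosed_closure
  have htsub : ∀ x ∈ Ω, x ∈ tsupport ψ → x ∈ Kc := fun x hx hxs =>
    ⟨subset_closure hx, Metric.self_subset_cthickening _ hxs⟩
  have hHK : ContinuousOn H Kc := hHc.mono inter_subset_left
  obtain ⟨MH, hMH⟩ := hKcpt.exists_bound_of_continuousOn hHK
  have hHm : AEStronglyMeasurable H (volume.restrict Ω) :=
    hH1.continuousOn.aestronglyMeasurable hΩo.measurableSet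
  have hfd : ∀ f : EuclideanSpace ℝ (Fin n) → ℝ,
      AEStronglyMeasurable (fun x => fderiv ℝ f x (H x)) (volume.restrict Ω) := fun f =>
    ContinuousLinearMap.aestronglyMeasurable_comp₂ (ContinuousLinearMap.id ℝ _)
      (measurable_fderiv ℝ f).aestronglyMeasurable hHm
  have hΩm := hΩo.measurableSet
  have hsuppfin : IsFiniteMeasure (volume.restrict (Ω ∩ tsupport ψ)) :=
    ⟨by
      rw [Measure.restrict_apply_univ]
      exact (measure_mono inter_subset_right).trans_lt hψc.isCompact.measure_lt_top⟩
  have hfdψ0 : ∀ x, x ∉ tsupport ψ → fderiv ℝ ψ x = 0 := fun x hx => by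
    by_contra hne
    exact hx (support_fderiv_subset ℝ hne)
  have hint2 : IntegrableOn (fun x => fderiv ℝ ψ x (H x)) Ω := by
    have h1 : IntegrableOn (fun x => fderiv ℝ ψ x (H x)) (Ω ∩ tsupport ψ) := by
      refine Integrable.of_bound ?_ (L * MH) ?_
      · exact (hfd ψ).mono_measure (Measure.restrict_mono_set _ inter_subset_left)
      · refine (ae_restrict_iff' (hΩm.inter (isClosed_tsupport ψ).measurableSet)).2
          (Filter.Eventually.of_forall fun x hx => ?_)
        exact (ContinuousLinearMap.le_opNorm _ _).trans (mul_le_mul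
          (norm_fderiv_le_of_lipschitz ℝ hψ) (hMH x (htsub x hx.1 hx.2)) (norm_nonneg _)
          (NNReal.coe_nonneg _))
    refine h1.of_forall_sdiff_eq_zero hΩm ?_
    intro x hx
    rw [hfdψ0 x (fun h => hx.2 ⟨hx.1, h⟩)]; rfl
  -- the limits
  have hmono : ∀ f : EuclideanSpace ℝ (Fin n) → ℝ, IntegrableOn f Ω →
      Filter.Tendsto (fun k => ∫ x in Ω, χ k x * f x) Filter.atTop (𝓝 (∫ x in Ω, f x)) := by
    intro f hf
    refine tendsto_integral_of_dominated_convergence (fun x => ‖f x‖) ?_ hf.norm ?_ ?_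
    · exact fun k => (hχL k).continuous.aestronglyMeasurable.mul hf.aestronglyMeasurable
    · refine fun k => Filter.Eventually.of_forall fun x => ?_
      rw [norm_mul]
      exact mul_le_of_le_one_left (norm_nonneg _) (hχ1 k x)
    · refine (ae_restrict_iff' hΩm).2 (Filter.Eventually.of_forall fun x hx => ?_)
      refine tendsto_const_nhds.congr' ?_
      filter_upwards [hχlim x hx] with k hk
      rw [hk, one_mul]
  obtain ⟨C, hC⟩ := hΩ.exists_strip_bound hΩo hΩc hψc.isCompact
  -- Width `3/N` rather than `2/N`, so that `χ` is constant in a whole neighbourhood of each point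
  -- outside the strip and its derivative vanishes there.
  set A : ℕ → Set (EuclideanSpace ℝ (Fin n)) := fun k =>
    tsupport ψ ∩ {x ∈ Ω | Metric.infDist x Ωᶜ < ((3 / N k : ℝ≥0) : ℝ)} with hA
  have hAvol : ∀ k, volume.real (A k) ≤ C * (3 / N k) := by
    intro k
    have hpos : (0 : ℝ≥0) < 3 / N k := div_pos (by norm_num) (NNReal.coe_pos.1 (hNpos k))
    have h1 := hC (3 / N k) hpos
    have h2 := ENNReal.toReal_mono (by finiteness) h1
    simpa [Measure.real, A] using h2
  set err : ℕ → ℝ := fun k => ∫ x in Ω, ψ x * fderiv ℝ (χ k) x (H x) with herr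
  -- The gradient of `χ` has size `N` and the strip has volume `O(1/N)`, so the error is governed by
  -- the normal component of `H`. That component vanishes at the nearest boundary point and is small
  -- nearby by uniform continuity.
  have herr0 : Filter.Tendsto err Filter.atTop (𝓝 0) := by
    rw [Metric.tendsto_atTop]
    intro ε hε
    -- The final bound on the error is `3 C a η`; the `+ 1` makes it strictly less than `ε` and
    -- avoids a zero denominator.
    set η := ε / (3 * C * a + 1) with hη
    have hden : (0 : ℝ) < 3 * C * a + 1 := by positivity
    have hηpos : 0 < η := by positivity
    have huc := hKcpt.uniformContinuousOn_of_continuous hHK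
    obtain ⟨d, hd, huc⟩ := Metric.uniformContinuousOn_iff.1 huc η hηpos
    obtain ⟨k0, hk0⟩ := exists_nat_gt (3 / min d 1)
    refine ⟨k0, fun k hk => ?_⟩
    have hsmall : 3 / (N k : ℝ) < min d 1 := by
      have h1 : (k0 : ℝ) ≤ k := by exact_mod_cast hk
      have h3 : (N k : ℝ) = k + 1 := by simp [hN]
      have h4 : 0 < min d 1 := lt_min hd one_pos
      rw [div_lt_iff₀ h4] at hk0
      rw [div_lt_iff₀ (hNpos k), h3]
      nlinarith
    have hAsub : A k ⊆ Ω := fun x hx => hx.2.1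
    have heq : err k = ∫ x in A k, ψ x * fderiv ℝ (χ k) x (H x) := by
      refine setIntegral_eq_of_subset_of_forall_sdiff_eq_zero hΩm hAsub ?_
      intro x hx
      by_cases hxs : x ∈ tsupport ψ
      · have h1 : 3 / (N k : ℝ) ≤ δ x := by
          by_contra! hcon
          exact hx.2 ⟨hxs, hx.1, by push_cast; exact hcon⟩
        rw [div_le_iff₀ (hNpos k)] at h1
        have h2 : χ k =ᶠ[𝓝 x] fun _ => 1 := by
          have hc : Continuous fun z => N k * δ z := continuous_const.mul hδL.continuous
          filter_upwards [hc.continuousAt.eventually (Ioi_mem_nhds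
            (show (2 : ℝ) < N k * δ x by linarith))] with z hz
          have hz : (2 : ℝ) < N k * δ z := hz
          exact clampUnit_of_one_le (by linarith)
        rw [h2.fderiv_eq]; simp
      · rw [image_eq_zero_of_notMem_tsupport hxs, zero_mul]
    have hbd : ∀ᵐ x, x ∈ A k → ‖ψ x * fderiv ℝ (χ k) x (H x)‖ ≤ a * (N k * η) := by
      filter_upwards [(hχL k).ae_differentiableAt, hδL.ae_differentiableAt] with x hx1 hx2 hxA
      obtain ⟨y, hyf, e, ν, hxy, he, hfe, hν, c, hc⟩ :=
        hΩ.exists_normal_of_differentiableAt_infDist hΩo hΩc hxA.2.1 hx2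
      have h1 := abs_fderiv_le_of_abs_sub_le hx1 hx2 (fun z => hχdiff k x z) (H x)
      have hxylt : dist x y < min d 1 := by
        rw [hxy]
        have := hxA.2.2
        push_cast at this
        exact this.trans hsmall
      have h2 : ‖H x - H y‖ < η := by
        rw [← dist_eq_norm]
        refine huc x (htsub x hxA.2.1 hxA.1) y ⟨frontier_subset_closure hyf, ?_⟩
          (hxylt.trans_le (min_le_left _ _))
        refine Metric.mem_cthickening_of_dist_le y x 1 _ hxA.1 ?_
        rw [dist_comm]
        exact (hxylt.trans_le (min_le_right _ _)).le
      have h3 : |fderiv ℝ δ x (H x)| ≤ η := by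
        have h4 : inner ℝ e (H y) = 0 := by
          rw [hc, inner_smul_left, real_inner_comm, hHν y hyf ν hν, mul_zero]
        have h5 : fderiv ℝ δ x (H x) = inner ℝ e (H x - H y) := by
          rw [inner_sub_right, h4, sub_zero]; exact hfe (H x)
        rw [h5]
        refine (abs_real_inner_le_norm _ _).trans ?_
        rw [he, one_mul]; exact h2.le
      rw [norm_mul]
      refine mul_le_mul (ha x) (h1.trans ?_) (norm_nonneg _) (NNReal.coe_nonneg _)
      gcongr
    have hfin : volume (A k) < ⊤ :=
      (measure_mono inter_subset_left).trans_lt hψc.isCompact.measure_lt_top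
    have h1 := norm_setIntegral_le_of_norm_le_const_ae' hfin hbd
    rw [← heq] at h1
    rw [dist_zero_right]
    refine lt_of_le_of_lt h1 ?_
    have h2 : a * (N k * η) * volume.real (A k) ≤ a * (N k * η) * (C * (3 / N k)) := by
      gcongr; exact hAvol k
    refine lt_of_le_of_lt h2 ?_
    have h3 : a * (N k * η) * (C * (3 / N k)) = 3 * C * a * η := by
      have := (hNpos k).ne'
      field_simp
    rw [h3, hη, mul_div_assoc', div_lt_iff₀ hden]
    nlinarith
  have hχfint : ∀ k, IntegrableOn (fun x => χ k x * fderiv ℝ ψ x (H x)) Ω := fun k =>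
    hint2.bdd_mul (c := 1) (hχL k).continuous.aestronglyMeasurable
      (Filter.Eventually.of_forall fun x => hχ1 k x)
  have herrint : ∀ k, IntegrableOn (fun x => ψ x * fderiv ℝ (χ k) x (H x)) Ω := by
    intro k
    have h1 : IntegrableOn (fun x => ψ x * fderiv ℝ (χ k) x (H x)) (Ω ∩ tsupport ψ) := by
      refine Integrable.of_bound ?_ (a * (N k * MH)) ?_
      · exact (hψ.continuous.aestronglyMeasurable.mul (hfd (χ k))).mono_measure
          (Measure.restrict_mono_set _ inter_subset_left)
      · refine (ae_restrict_iff' (hΩm.inter (isClosed_tsupport ψ).measurableSet)).2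
          (Filter.Eventually.of_forall fun x hx => ?_)
        rw [norm_mul]
        refine mul_le_mul (ha x) ?_ (norm_nonneg _) (NNReal.coe_nonneg _)
        exact (ContinuousLinearMap.le_opNorm _ _).trans (mul_le_mul
          (norm_fderiv_le_of_lipschitz ℝ (hχL k)) (hMH x (htsub x hx.1 hx.2)) (norm_nonneg _)
          (NNReal.coe_nonneg _))
    refine h1.of_forall_sdiff_eq_zero hΩm ?_
    intro x hx
    rw [image_eq_zero_of_notMem_tsupport (fun h => hx.2 ⟨hx.1, h⟩), zero_mul]
  have hsplit : ∀ k, ∫ x in Ω, fderiv ℝ (fun x => ψ x * χ k x) x (H x) =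
      (∫ x in Ω, χ k x * fderiv ℝ ψ x (H x)) + err k := by
    intro k
    simp only [herr]
    rw [← integral_add (hχfint k) (herrint k)]
    refine integral_congr_ae (ae_restrict_of_ae ?_)
    filter_upwards [(hχL k).ae_differentiableAt, hψ.ae_differentiableAt] with x hx1 hx2
    rw [fderiv_fun_mul hx2 hx1]
    simp
    ring
  have hlim1 := hmono _ hint
  have hlim2 := ((hmono _ hint2).add herr0).neg
  rw [add_zero] at hlim2
  refine tendsto_nhds_unique hlim1 (hlim2.congr fun k => ?_)
  rw [hIBP k, hsplit k]

/-! ### Straight cylinders -/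

@[simp] theorem axialPoint_last {d : ℕ} (x' : EuclideanSpace ℝ (Fin d)) (t : ℝ) :
    axialPoint x' t (Fin.last d) = t := by simp [axialPoint]

@[simp] theorem axialPoint_castSucc {d : ℕ} (x' : EuclideanSpace ℝ (Fin d)) (t : ℝ) (i : Fin d) :
    axialPoint x' t i.castSucc = x' i := by simp [axialPoint]

/-- The splitting `ℝ^{d+1} = ℝ^d × ℝ`. -/
noncomputable def axialEquiv (d : ℕ) :
    (EuclideanSpace ℝ (Fin d) × ℝ) ≃L[ℝ] EuclideanSpace ℝ (Fin (d + 1)) :=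
  LinearEquiv.toContinuousLinearEquiv
    { toFun := fun q => axialPoint q.1 q.2
      invFun := fun x => (WithLp.toLp 2 fun i => x i.castSucc, x (Fin.last d))
      map_add' := fun q r => by
        ext i
        refine Fin.lastCases ?_ (fun i => ?_) i <;> simp
      map_smul' := fun c q => by
        ext i
        refine Fin.lastCases ?_ (fun i => ?_) i <;> simp
      left_inv := fun q => by
        refine Prod.ext ?_ ?_
        · ext i; simp
        · simp
      right_inv := fun x => by
        ext i
        refine Fin.lastCases ?_ (fun i => ?_) i <;> simp }

@[simp] theorem axialEquiv_apply {d : ℕ} (q : EuclideanSpace ℝ (Fin d) × ℝ) :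
    axialEquiv d q = axialPoint q.1 q.2 := rfl

/-- The projection `(x', t) ↦ x'`. -/
noncomputable def crossProj (d : ℕ) : EuclideanSpace ℝ (Fin (d + 1)) →L[ℝ] EuclideanSpace ℝ (Fin d) :=
  (ContinuousLinearMap.fst ℝ _ _).comp (axialEquiv d).symm.toContinuousLinearMap

@[simp] theorem crossProj_axialPoint {d : ℕ} (x' : EuclideanSpace ℝ (Fin d)) (t : ℝ) :
    crossProj d (axialPoint x' t) = x' := by
  have := (axialEquiv d).symm_apply_apply (x', t)
  simp only [axialEquiv_apply] at this
  simp [crossProj, this]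

theorem axialPoint_crossProj {d : ℕ} (x : EuclideanSpace ℝ (Fin (d + 1))) :
    axialPoint (crossProj d x) (x (Fin.last d)) = x :=
  (axialEquiv d).apply_symm_apply x

theorem continuous_axialPoint {d : ℕ} :
    Continuous fun q : EuclideanSpace ℝ (Fin d) × ℝ => axialPoint q.1 q.2 :=
  (axialEquiv d).continuous

theorem isOpenMap_crossProj (d : ℕ) : IsOpenMap (crossProj d) :=
  isOpenMap_fst.comp (axialEquiv d).symm.toHomeomorph.isOpenMap

theorem axialPoint_add_smul {d : ℕ} (x : EuclideanSpace ℝ (Fin (d + 1))) (s : ℝ) :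
    x + s • EuclideanSpace.single (Fin.last d) (1 : ℝ) =
      axialPoint (crossProj d x) (x (Fin.last d) + s) := by
  conv_lhs => rw [← axialPoint_crossProj x]
  ext i
  refine Fin.lastCases ?_ (fun i => ?_) i
  · simp
  · simp [(Fin.castSucc_lt_last i).ne]

theorem norm_axialPoint_zero_le {d : ℕ} (v : EuclideanSpace ℝ (Fin d)) :
    ‖axialPoint v 0‖ ≤ ‖v‖ := by
  rw [EuclideanSpace.norm_eq, EuclideanSpace.norm_eq, Fin.sum_univ_castSucc]
  simp

theorem straightCylinder_eq {d : ℕ} (S : Set (EuclideanSpace ℝ (Fin d))) :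
    straightCylinder S = crossProj d ⁻¹' S := by
  ext x
  constructor
  · rintro ⟨x', hx', t, rfl⟩
    simpa using hx'
  · intro hx
    exact ⟨_, hx, _, (axialPoint_crossProj x).symm⟩

@[simp] theorem axialPoint_mem_straightCylinder {d : ℕ} {S : Set (EuclideanSpace ℝ (Fin d))}
    {x' : EuclideanSpace ℝ (Fin d)} {t : ℝ} : axialPoint x' t ∈ straightCylinder S ↔ x' ∈ S := by
  rw [straightCylinder_eq]; simp

theorem isOpen_straightCylinder {d : ℕ} {S : Set (EuclideanSpace ℝ (Fin d))} (hS : IsOpen S) :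
    IsOpen (straightCylinder S) := by
  rw [straightCylinder_eq]; exact hS.preimage (crossProj d).continuous

theorem isPreconnected_straightCylinder {d : ℕ} {S : Set (EuclideanSpace ℝ (Fin d))}
    (hS : IsPreconnected S) : IsPreconnected (straightCylinder S) := by
  have : straightCylinder S = axialEquiv d '' (S ×ˢ univ) := by
    ext x
    constructor
    · rintro ⟨x', hx', t, rfl⟩
      exact ⟨(x', t), ⟨hx', mem_univ _⟩, rfl⟩
    · rintro ⟨⟨x', t⟩, hx', rfl⟩
      exact ⟨x', hx'.1, t, rfl⟩
  rw [this]
  exact (hS.prod isPreconnected_univ).image _ (axialEquiv d).continuous.continuousOn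

theorem frontier_straightCylinder {d : ℕ} (S : Set (EuclideanSpace ℝ (Fin d))) :
    frontier (straightCylinder S) = crossProj d ⁻¹' frontier S := by
  rw [straightCylinder_eq,
    (isOpenMap_crossProj d).preimage_frontier_eq_frontier_preimage (crossProj d).continuous]

theorem HasC1Boundary.straightCylinder {d : ℕ} {S : Set (EuclideanSpace ℝ (Fin d))}
    (hS : HasC1Boundary S) : HasC1Boundary (straightCylinder S) := by
  intro x hx
  rw [frontier_straightCylinder] at hx
  obtain ⟨U, g, hxU, hg⟩ := hS _ hx
  refine ⟨crossProj d ⁻¹' U, g ∘ crossProj d, hxU, ?_, ?_, ?_, ?_⟩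
  · exact hg.isOpen.preimage (crossProj d).continuous
  · exact hg.contDiffOn.comp (crossProj d).contDiff.contDiffOn (mapsTo_preimage _ _)
  · intro y hy h0
    apply hg.gradient_ne_zero _ hy
    refine ext_inner_right ℝ fun v => ?_
    have h1 : fderiv ℝ (g ∘ crossProj d) y (axialPoint v 0) = 0 := by
      rw [← inner_gradient_left, h0, inner_zero_left]
    rw [fderiv_comp y (hg.differentiableAt hy) (crossProj d).differentiableAt,
      ContinuousLinearMap.fderiv] at h1
    rw [inner_gradient_left, inner_zero_left]
    simpa using h1
  · ext y
    rw [straightCylinder_eq]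
    have := Set.ext_iff.1 hg.inter_eq (crossProj d y)
    exact this

/-- Normals to a straight cylinder are orthogonal to the axis. -/
theorem IsOuterUnitNormal.apply_last_eq_zero {d : ℕ} {S : Set (EuclideanSpace ℝ (Fin d))}
    (hS : IsOpen S) {x ν : EuclideanSpace ℝ (Fin (d + 1))}
    (hx : x ∈ frontier (_root_.straightCylinder S))
    (hν : IsOuterUnitNormal (_root_.straightCylinder S) x ν) : ν (Fin.last d) = 0 := by
  obtain ⟨U, g, hxU, hg, rfl⟩ := hν
  set e : EuclideanSpace ℝ (Fin (d + 1)) := EuclideanSpace.single (Fin.last d) 1 with he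
  have hline : HasDerivAt (fun s : ℝ => g (x + s • e)) (inner ℝ (gradient g x) e) 0 := by
    have h1 : HasFDerivAt g (fderiv ℝ g x) (x + (0 : ℝ) • e) := by
      simpa using (hg.differentiableAt hxU).hasFDerivAt
    have h2 : HasDerivAt (fun s : ℝ => x + s • e) e 0 := by
      simpa using ((hasDerivAt_id (0 : ℝ)).smul_const e).const_add x
    have := h1.comp_hasDerivAt (0 : ℝ) h2
    rw [inner_gradient_left]
    exact this
  -- The lateral boundary is invariant under axial translation, so any defining function vanishes
  -- along the axial line through `x`.
  have hzero : (fun s : ℝ => g (x + s • e)) =ᶠ[𝓝 0] fun _ => 0 := by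
    have hc : Continuous fun s : ℝ => x + s • e := by fun_prop
    filter_upwards [hc.continuousAt.eventually (hg.isOpen.mem_nhds
      (show x + (0 : ℝ) • e ∈ U by simpa using hxU))] with s hs
    refine hg.eq_zero_of_mem_frontier (isOpen_straightCylinder hS) hs ?_
    rw [frontier_straightCylinder] at hx ⊢
    rw [he, axialPoint_add_smul]
    simpa using hx
  have h0 : inner ℝ (gradient g x) e = 0 :=
    hline.unique ((hasDerivAt_const (0 : ℝ) (0 : ℝ)).congr_of_eventuallyEq hzero)
  rw [he, EuclideanSpace.inner_single_right] at h0
  simp only [one_mul, conj_trivial] at h0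
  simp [h0]

theorem measurePreserving_axialEquiv (d : ℕ) :
    MeasurePreserving (axialEquiv d) (volume : Measure (EuclideanSpace ℝ (Fin d) × ℝ)) volume := by
  -- The swap is needed because `piFinSuccAbove` puts the distinguished coordinate first.
  have h1 : MeasurePreserving (fun q : EuclideanSpace ℝ (Fin d) × ℝ => (q.2, WithLp.ofLp q.1))
      volume (volume : Measure (ℝ × (Fin d → ℝ))) :=
    Measure.measurePreserving_swap.comp
      ((EuclideanSpace.volume_preserving_symm_measurableEquiv_toLp (Fin d)).prod
        (MeasurePreserving.id (volume : Measure ℝ)))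
  have h2 := (volume_preserving_piFinSuccAbove (fun _ : Fin (d + 1) => ℝ) (Fin.last d)).symm
  have h3 := (EuclideanSpace.volume_preserving_symm_measurableEquiv_toLp (Fin (d + 1))).symm
  have h4 := h3.comp (h2.comp h1)
  convert! h4 using 1
  ext q i
  refine Fin.lastCases ?_ (fun i => ?_) i
  · simp [MeasurableEquiv.piFinSuccAbove, Fin.insertNthEquiv]
  · simp [MeasurableEquiv.piFinSuccAbove, Fin.insertNthEquiv]

theorem preimage_axialEquiv_straightCylinder {d : ℕ} (S : Set (EuclideanSpace ℝ (Fin d)))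
    (J : Set ℝ) : axialEquiv d ⁻¹' (straightCylinder S ∩ {x | x (Fin.last d) ∈ J}) = S ×ˢ J := by
  ext q
  simp [Set.mem_prod]

theorem volume_straightCylinder_inter {d : ℕ} {S : Set (EuclideanSpace ℝ (Fin d))}
    (J : Set ℝ) :
    volume (straightCylinder S ∩ {x | x (Fin.last d) ∈ J}) = volume S * volume J := by
  rw [← (measurePreserving_axialEquiv d).measure_preimage_emb
    (axialEquiv d).toHomeomorph.measurableEmbedding, preimage_axialEquiv_straightCylinder]
  exact Measure.prod_prod S J

theorem integral_straightCylinder {d : ℕ} {S : Set (EuclideanSpace ℝ (Fin d))}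
    {f : EuclideanSpace ℝ (Fin (d + 1)) → ℝ} (hf : IntegrableOn f (straightCylinder S)) :
    ∫ x in straightCylinder S, f x = ∫ t : ℝ, ∫ x' in S, f (axialPoint x' t) := by
  have hemb := (axialEquiv d).toHomeomorph.measurableEmbedding
  have hpre : axialEquiv d ⁻¹' straightCylinder S = S ×ˢ univ := by
    have := preimage_axialEquiv_straightCylinder S univ
    simpa using this
  have h1 := (measurePreserving_axialEquiv d).setIntegral_preimage_emb hemb f (straightCylinder S)
  have h2 := ((measurePreserving_axialEquiv d).integrableOn_comp_preimage hemb).2 hf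
  rw [hpre] at h1 h2
  have hvol : (volume : Measure (EuclideanSpace ℝ (Fin d) × ℝ)).restrict (S ×ˢ univ) =
      (volume.restrict S).prod volume := by
    rw [Measure.volume_eq_prod, ← Measure.prod_restrict, Measure.restrict_univ]
  rw [IntegrableOn, hvol] at h2
  rw [← h1, hvol]
  exact integral_prod_symm _ h2

/-! ### Energy estimate in a straight cylinder -/

/-- The piecewise linear cutoff that is `1` on `[-T, T]` and `0` outside `[-(T + 1), T + 1]`. -/
noncomputable def trapezoid (T t : ℝ) : ℝ := clampUnit (T + 1 - |t|)

theorem lipschitzWith_trapezoid (T : ℝ) : LipschitzWith 1 (trapezoid T) := by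
  refine LipschitzWith.of_dist_le_mul fun s t => ?_
  have h1 := lipschitzWith_clampUnit.dist_le_mul (T + 1 - |s|) (T + 1 - |t|)
  simp only [NNReal.coe_one, one_mul, Real.dist_eq, sub_sub_sub_cancel_left] at h1 ⊢
  refine h1.trans ?_
  rw [abs_sub_comm |t|]
  exact abs_abs_sub_abs_le_abs_sub s t

theorem trapezoid_eq_one {T t : ℝ} (h : |t| ≤ T) : trapezoid T t = 1 :=
  clampUnit_of_one_le (by linarith)

theorem trapezoid_eq_zero {T t : ℝ} (h : T + 1 ≤ |t|) : trapezoid T t = 0 :=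
  clampUnit_of_nonpos (by linarith)

theorem abs_deriv_trapezoid_le (T t : ℝ) : |deriv (trapezoid T) t| ≤ 1 := by
  simpa using norm_deriv_le_of_lipschitz (x₀ := t) (lipschitzWith_trapezoid T)

theorem deriv_trapezoid_eq_zero {T t : ℝ} (h : |t| < T ∨ T + 1 < |t|) :
    deriv (trapezoid T) t = 0 := by
  rcases h with h | h
  · have : trapezoid T =ᶠ[𝓝 t] fun _ => 1 := by
      filter_upwards [continuous_abs.continuousAt.eventually (Iio_mem_nhds h)] with s hs
      exact trapezoid_eq_one (le_of_lt hs)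
    rw [this.deriv_eq]; simp
  · have : trapezoid T =ᶠ[𝓝 t] fun _ => 0 := by
      filter_upwards [continuous_abs.continuousAt.eventually (Ioi_mem_nhds h)] with s hs
      exact trapezoid_eq_zero (le_of_lt hs)
    rw [this.deriv_eq]; simp

/-- Valid also where `ψ` is not differentiable: the composition is not differentiable there either,
and both default derivatives are zero. The kinks of the trapezoid thus need no almost-everywhere
argument. -/
theorem fderiv_comp_last {d : ℕ} (ψ : ℝ → ℝ) (x v : EuclideanSpace ℝ (Fin (d + 1))) :
    fderiv ℝ (fun x : EuclideanSpace ℝ (Fin (d + 1)) => ψ (x (Fin.last d))) x v =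
      deriv ψ (x (Fin.last d)) * v (Fin.last d) := by
  set π : EuclideanSpace ℝ (Fin (d + 1)) →L[ℝ] ℝ := EuclideanSpace.proj (Fin.last d) with hπ
  by_cases h : DifferentiableAt ℝ ψ (x (Fin.last d))
  · have h1 : HasFDerivAt (fun x : EuclideanSpace ℝ (Fin (d + 1)) => ψ (x (Fin.last d)))
        (deriv ψ (x (Fin.last d)) • π) x :=
      HasDerivAt.comp_hasFDerivAt x (h₂ := ψ) (f := π) h.hasDerivAt π.hasFDerivAt
    rw [h1.fderiv]
    simp [hπ]
  · have h1 : ¬ DifferentiableAt ℝ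
        (fun x : EuclideanSpace ℝ (Fin (d + 1)) => ψ (x (Fin.last d))) x := by
      intro hcon
      apply h
      have h2 : DifferentiableAt ℝ (fun s : ℝ => axialPoint (crossProj d x) s)
          (x (Fin.last d)) := by
        have : DifferentiableAt ℝ (fun s : ℝ => axialEquiv d (crossProj d x, s))
            (x (Fin.last d)) := by fun_prop
        exact this
      have h3 : DifferentiableAt ℝ
          (fun x : EuclideanSpace ℝ (Fin (d + 1)) => ψ (x (Fin.last d)))
          (axialPoint (crossProj d x) (x (Fin.last d))) := by
        rwa [axialPoint_crossProj]
      have h4 := h3.comp (x (Fin.last d)) h2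
      have h5 : (fun x : EuclideanSpace ℝ (Fin (d + 1)) => ψ (x (Fin.last d))) ∘
          (fun s : ℝ => axialPoint (crossProj d x) s) = ψ := by
        ext s; simp
      rwa [h5] at h4
    rw [fderiv_zero_of_not_differentiableAt h1, deriv_zero_of_not_differentiableAt h]
    simp

theorem volume_straightCylinder_inter_lt_top {d : ℕ} {S : Set (EuclideanSpace ℝ (Fin d))}
    (hSb : Bornology.IsBounded S) (T : ℝ) :
    volume (straightCylinder S ∩ {x | x (Fin.last d) ∈ {t : ℝ | |t| ≤ T}}) < ⊤ := by
  rw [volume_straightCylinder_inter]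
  refine ENNReal.mul_lt_top hSb.measure_lt_top ?_
  have : {t : ℝ | |t| ≤ T} = Icc (-T) T := by ext t; simp [abs_le]
  rw [this]
  exact measure_Icc_lt_top

theorem integrableOn_straightCylinder_of_bounded {d : ℕ} {S : Set (EuclideanSpace ℝ (Fin d))}
    (hS : IsOpen S) (hSb : Bornology.IsBounded S) {f : EuclideanSpace ℝ (Fin (d + 1)) → ℝ}
    (hfm : AEStronglyMeasurable f (volume.restrict (straightCylinder S))) {M T : ℝ}
    (hM : ∀ x ∈ straightCylinder S, |x (Fin.last d)| ≤ T → |f x| ≤ M)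
    (hT : ∀ x ∈ straightCylinder S, T < |x (Fin.last d)| → f x = 0) :
    IntegrableOn f (straightCylinder S) := by
  set Q := straightCylinder S ∩ {x | x (Fin.last d) ∈ {t : ℝ | |t| ≤ T}} with hQ
  have hΩm := (isOpen_straightCylinder hS).measurableSet
  have hQm : MeasurableSet Q := by
    refine hΩm.inter (IsClosed.measurableSet ?_)
    exact isClosed_le (f := fun x : EuclideanSpace ℝ (Fin (d + 1)) => |x (Fin.last d)|)
      (by fun_prop) continuous_const
  have hfin : IsFiniteMeasure (volume.restrict Q) :=
    ⟨by rw [Measure.restrict_apply_univ]; exact volume_straightCylinder_inter_lt_top hSb T⟩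
  have h1 : IntegrableOn f Q := by
    refine Integrable.of_bound (hfm.mono_measure (Measure.restrict_mono_set _ inter_subset_left))
      M ?_
    exact (ae_restrict_iff' hQm).2 (Filter.Eventually.of_forall fun x hx => hM x hx.1 hx.2)
  refine h1.of_forall_sdiff_eq_zero hΩm ?_
  intro x hx
  refine hT x hx.1 (not_le.1 fun h => hx.2 ⟨hx.1, h⟩)

/-- A monotone bounded sequence that is controlled by its increments vanishes. -/
theorem nonpos_of_le_increment {E : ℕ → ℝ} (hmono : Monotone E) (hbdd : BddAbove (range E))
    {a b : ℝ} (h : ∀ lam, 0 < lam → ∀ k, E k ≤ lam * a + b / lam * (E (k + 1) - E k)) (k : ℕ) :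
    E k ≤ 0 := by
  -- A bounded monotone sequence converges, so its increments tend to zero. With `lam` fixed the
  -- limit is at most `lam * a`; only then does `lam` tend to `0`.
  have hlim := tendsto_atTop_ciSup hmono hbdd
  set L := ⨆ k, E k with hL
  have hlim' := hlim.comp (Filter.tendsto_add_atTop_nat 1)
  have hle : ∀ lam : ℝ, 0 < lam → L ≤ lam * a := by
    intro lam hlam
    have h1 := ((hlim'.sub hlim).const_mul (b / lam)).const_add (lam * a)
    rw [sub_self, mul_zero, add_zero] at h1
    exact le_of_tendsto_of_tendsto' hlim h1 fun k => h lam hlam k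
  have hL0 : L ≤ 0 := by
    have hc : Continuous fun lam : ℝ => lam * a := by fun_prop
    have h1 : Filter.Tendsto (fun lam : ℝ => lam * a) (𝓝[>] 0) (𝓝 0) := by
      have := (hc.tendsto 0).mono_left (nhdsWithin_le_nhds (s := Ioi (0 : ℝ)))
      simpa using this
    exact ge_of_tendsto h1 (by filter_upwards [self_mem_nhdsWithin] with lam hlam using hle lam hlam)
  exact (le_ciSup hbdd k).trans hL0

/-- The data of the energy estimate: a solenoidal field `F` that is tangential to the lateral
boundary and has no flux through the cross sections, and a function `u` with bounded oscillation
on the cross sections. -/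
structure IsEnergyPair {d : ℕ} (S : Set (EuclideanSpace ℝ (Fin d)))
    (F : EuclideanSpace ℝ (Fin (d + 1)) → EuclideanSpace ℝ (Fin (d + 1)))
    (u : EuclideanSpace ℝ (Fin (d + 1)) → ℝ) (K M M' : ℝ) : Prop where
  field_contDiffOn : ContDiffOn ℝ 1 F (straightCylinder S)
  field_continuousOn : ContinuousOn F (closure (straightCylinder S))
  field_tangential : ∀ x ∈ frontier (straightCylinder S), ∀ ν,
    IsOuterUnitNormal (straightCylinder S) x ν → inner ℝ (F x) ν = 0
  field_bound : ∀ x ∈ straightCylinder S, ‖F x‖ ≤ M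
  field_div : ∀ x ∈ straightCylinder S, divergence F x = 0
  field_flux : ∀ t : ℝ, ∫ x' in S, F (axialPoint x' t) (Fin.last d) = 0
  contDiffOn : ContDiffOn ℝ 1 u (straightCylinder S)
  continuousOn : ContinuousOn u (closure (straightCylinder S))
  osc : ∀ x ∈ S, ∀ y ∈ S, ∀ t : ℝ, |u (axialPoint x t) - u (axialPoint y t)| ≤ K
  energy_bound : ∀ x ∈ straightCylinder S, |fderiv ℝ u x (F x)| ≤ M'

theorem divergence_smul {n : ℕ} {u : EuclideanSpace ℝ (Fin n) → ℝ}
    {F : EuclideanSpace ℝ (Fin n) → EuclideanSpace ℝ (Fin n)} {x : EuclideanSpace ℝ (Fin n)}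
    (hu : DifferentiableAt ℝ u x) (hF : DifferentiableAt ℝ F x) :
    divergence (fun x => u x • F x) x = u x * divergence F x + fderiv ℝ u x (F x) := by
  rw [divergence, divergence, fderiv_fun_smul hu hF]
  conv_rhs => rw [← (EuclideanSpace.basisFun (Fin n) ℝ).sum_repr (F x), map_sum, Finset.mul_sum,
    ← Finset.sum_add_distrib]
  refine Finset.sum_congr rfl fun i _ => ?_
  simp
  ring

namespace IsEnergyPair

variable {d : ℕ} {S : Set (EuclideanSpace ℝ (Fin d))}
  {F : EuclideanSpace ℝ (Fin (d + 1)) → EuclideanSpace ℝ (Fin (d + 1))}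
  {u : EuclideanSpace ℝ (Fin (d + 1)) → ℝ} {K M M' : ℝ}

theorem continuousOn_energy (h : IsEnergyPair S F u K M M') (hS : IsOpen S) :
    ContinuousOn (fun x => fderiv ℝ u x (F x)) (straightCylinder S) :=
  (h.contDiffOn.continuousOn_fderiv_of_isOpen (isOpen_straightCylinder hS) le_rfl).clm_apply
    h.field_contDiffOn.continuousOn

/-- The divergence theorem is applied to `u F`, whose divergence is `∇u · F`. The remaining integral
contains `θ u Fₙ`, with `θ` the derivative of the cutoff; zero flux allows `u` to be replaced by its
deviation from the value at a fixed point of the cross section, which is at most `K`. -/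
theorem integral_trapezoid_mul_le (h : IsEnergyPair S F u K M M') (hS : IsOpen S)
    (hSb : Bornology.IsBounded S) (hSc : Sᶜ.Nonempty) (hSn : S.Nonempty) (hS1 : HasC1Boundary S)
    (T : ℝ) :
    ∫ x in straightCylinder S, trapezoid T (x (Fin.last d)) * fderiv ℝ u x (F x) ≤
      ∫ x in straightCylinder S ∩ {x | |x (Fin.last d)| ∈ Icc T (T + 1)}, K * ‖F x‖ := by
  set Ω := straightCylinder S with hΩ
  have hΩo : IsOpen Ω := isOpen_straightCylinder hS
  have hΩm := hΩo.measurableSet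
  have hΩc : Ωᶜ.Nonempty := by
    obtain ⟨y, hy⟩ := hSc
    exact ⟨axialPoint y 0, by simpa [hΩ] using hy⟩
  obtain ⟨a, ha⟩ := hSn
  have hK : 0 ≤ K := (abs_nonneg _).trans (h.osc a ha a ha 0)
  have hlast : Continuous fun x : EuclideanSpace ℝ (Fin (d + 1)) => x (Fin.last d) := by fun_prop
  obtain ⟨R, hR⟩ := hSb.exists_norm_le
  -- The second factor equals `1` near every point of the cylinder, as `|x'| ≤ R` on `S`; it only
  -- makes the test function compactly supported in the whole space.
  set ψ : EuclideanSpace ℝ (Fin (d + 1)) → ℝ := fun x => trapezoid T (x (Fin.last d)) *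
    clampUnit (R + 2 - ‖crossProj d x‖) with hψ
  have hψL : LipschitzWith (1 * 1 + 1 * ‖crossProj d‖₊) ψ := by
    refine LipschitzWith.mul_of_bounded (LipschitzWith.of_dist_le_mul fun x y => ?_)
      (LipschitzWith.of_dist_le_mul fun x y => ?_) (fun x => abs_clampUnit_le_one _)
      (fun x => abs_clampUnit_le_one _)
    · refine ((lipschitzWith_trapezoid T).dist_le_mul _ _).trans ?_
      rw [NNReal.coe_one, one_mul, one_mul, dist_eq_norm, dist_eq_norm]
      exact PiLp.norm_apply_le (x - y) (Fin.last d)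
    · refine (lipschitzWith_clampUnit.dist_le_mul _ _).trans ?_
      rw [NNReal.coe_one, one_mul, Real.dist_eq, sub_sub_sub_cancel_left, dist_eq_norm]
      refine (abs_norm_sub_norm_le _ _).trans ?_
      rw [← map_sub, norm_sub_rev x y]
      exact (crossProj d).le_opNorm _
  have hψc : HasCompactSupport ψ := by
    refine HasCompactSupport.intro (K := axialEquiv d ''
      (Metric.closedBall 0 (R + 2) ×ˢ Metric.closedBall 0 (T + 1))) ?_ ?_
    · exact ((isCompact_closedBall _ _).prod (isCompact_closedBall _ _)).image
        (axialEquiv d).continuous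
    · intro x hx
      by_contra hne
      apply hx
      refine ⟨(crossProj d x, x (Fin.last d)), ⟨?_, ?_⟩, axialPoint_crossProj x⟩
      · rw [mem_closedBall_zero_iff]
        by_contra! hcon
        apply hne
        simp only [hψ]
        rw [clampUnit_of_nonpos (by linarith), mul_zero]
      · rw [mem_closedBall_zero_iff, Real.norm_eq_abs]
        by_contra! hcon
        apply hne
        simp only [hψ]
        rw [trapezoid_eq_zero hcon.le, zero_mul]
  have hψloc : ∀ x ∈ Ω, ψ =ᶠ[𝓝 x] fun x => trapezoid T (x (Fin.last d)) := by
    intro x hx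
    have hx' : crossProj d x ∈ S := by rwa [hΩ, straightCylinder_eq] at hx
    have hc : Continuous fun x => ‖crossProj d x‖ := (crossProj d).continuous.norm
    filter_upwards [hc.continuousAt.eventually (Iio_mem_nhds
      (show ‖crossProj d x‖ < R + 1 by linarith [hR _ hx']))] with y hy
    have hy : ‖crossProj d y‖ < R + 1 := hy
    simp only [hψ]
    rw [clampUnit_of_one_le (by linarith), mul_one]
  set D : EuclideanSpace ℝ (Fin (d + 1)) → ℝ := fun x => fderiv ℝ u x (F x) with hD
  have hDc : ContinuousOn D Ω := h.continuousOn_energy hS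
  have hdiv : ∀ x ∈ Ω, divergence (fun x => u x • F x) x = D x := by
    intro x hx
    rw [divergence_smul ((h.contDiffOn.contDiffAt (hΩo.mem_nhds hx)).differentiableAt one_ne_zero)
      ((h.field_contDiffOn.contDiffAt (hΩo.mem_nhds hx)).differentiableAt one_ne_zero),
      h.field_div x hx, mul_zero, zero_add]
  have hψD : ∀ x ∈ Ω, ψ x * divergence (fun x => u x • F x) x =
      trapezoid T (x (Fin.last d)) * D x := fun x hx => by
    rw [hdiv x hx, (hψloc x hx).eq_of_nhds]
  have hint : IntegrableOn (fun x => trapezoid T (x (Fin.last d)) * D x) Ω := by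
    refine integrableOn_straightCylinder_of_bounded hS hSb (M := M') (T := T + 1) ?_ ?_ ?_
    · exact ((lipschitzWith_trapezoid T).continuous.comp hlast).aestronglyMeasurable.mul
        (hDc.aestronglyMeasurable hΩm)
    · intro x hx _
      rw [abs_mul]
      exact (mul_le_of_le_one_left (abs_nonneg _) (abs_clampUnit_le_one _)).trans
        (h.energy_bound x hx)
    · intro x _ hxT
      rw [trapezoid_eq_zero hxT.le, zero_mul]
  have hmain := hS1.straightCylinder.integral_mul_divergence (H := fun x => u x • F x) hΩo hΩc
    (h.contDiffOn.smul h.field_contDiffOn) (h.continuousOn.smul h.field_continuousOn)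
    (fun x hx ν hν => by rw [inner_smul_left, h.field_tangential x hx ν hν, mul_zero]) hψL hψc
    (hint.congr_fun (fun x hx => (hψD x hx).symm) hΩm)
  rw [← hΩ, setIntegral_congr_fun hΩm hψD] at hmain
  set θ : ℝ → ℝ := deriv (trapezoid T) with hθ
  have hfd : ∀ x ∈ Ω, fderiv ℝ ψ x (u x • F x) =
      θ (x (Fin.last d)) * (u x * F x (Fin.last d)) := by
    intro x hx
    rw [(hψloc x hx).fderiv_eq, fderiv_comp_last]
    simp [hθ]
  rw [setIntegral_congr_fun hΩm hfd] at hmain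
  -- subtract the value at a reference point of the cross section
  have haΩ : ∀ t, axialPoint a t ∈ Ω := fun t => by simpa [hΩ] using ha
  have hcc : Continuous fun t : ℝ => u (axialPoint a t) := by
    refine h.contDiffOn.continuousOn.comp_continuous ?_ haΩ
    exact continuous_axialPoint.comp (by fun_prop : Continuous fun t : ℝ => (a, t))
  have hθm : AEStronglyMeasurable
      (fun x : EuclideanSpace ℝ (Fin (d + 1)) => θ (x (Fin.last d))) (volume.restrict Ω) :=
    ((measurable_deriv _).comp hlast.measurable).aestronglyMeasurable
  have hFm : AEStronglyMeasurable (fun x => F x (Fin.last d)) (volume.restrict Ω) := by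
    have : ContinuousOn (fun x => F x (Fin.last d)) Ω :=
      hlast.comp_continuousOn h.field_contDiffOn.continuousOn
    exact this.aestronglyMeasurable hΩm
  have hFn : ∀ x, |F x (Fin.last d)| ≤ ‖F x‖ := fun x => PiLp.norm_apply_le (F x) (Fin.last d)
  have hosc : ∀ x ∈ Ω, |u x - u (axialPoint a (x (Fin.last d)))| ≤ K := by
    intro x hx
    have hx' : crossProj d x ∈ S := by rwa [hΩ, straightCylinder_eq] at hx
    have := h.osc _ hx' a ha (x (Fin.last d))
    rwa [axialPoint_crossProj] at this
  set f₁ : EuclideanSpace ℝ (Fin (d + 1)) → ℝ := fun x => θ (x (Fin.last d)) *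
    ((u x - u (axialPoint a (x (Fin.last d)))) * F x (Fin.last d)) with hf₁
  set f₂ : EuclideanSpace ℝ (Fin (d + 1)) → ℝ := fun x => θ (x (Fin.last d)) *
    (u (axialPoint a (x (Fin.last d))) * F x (Fin.last d)) with hf₂
  have hf₁le : ∀ x ∈ Ω, |f₁ x| ≤ K * ‖F x‖ := by
    intro x hx
    rw [hf₁]
    simp only [abs_mul]
    refine (mul_le_of_le_one_left (by positivity) (abs_deriv_trapezoid_le T _)).trans ?_
    exact mul_le_mul (hosc x hx) (hFn x) (abs_nonneg _) hK
  have hf₁int : IntegrableOn f₁ Ω := by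
    refine integrableOn_straightCylinder_of_bounded hS hSb (M := K * M) (T := T + 1) ?_ ?_ ?_
    · refine hθm.mul (AEStronglyMeasurable.mul ?_ hFm)
      exact (h.contDiffOn.continuousOn.aestronglyMeasurable hΩm).sub
        (hcc.comp hlast).aestronglyMeasurable
    · intro x hx _
      exact (hf₁le x hx).trans (mul_le_mul_of_nonneg_left (h.field_bound x hx) hK)
    · intro x _ hxT
      simp only [hf₁, hθ]
      rw [deriv_trapezoid_eq_zero (Or.inr hxT), zero_mul]
  obtain ⟨Cc, hCc⟩ := (isCompact_Icc (a := -(T + 1)) (b := T + 1)).exists_bound_of_continuousOn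
    hcc.continuousOn
  have hf₂int : IntegrableOn f₂ Ω := by
    refine integrableOn_straightCylinder_of_bounded hS hSb (M := Cc * M) (T := T + 1) ?_ ?_ ?_
    · exact hθm.mul ((hcc.comp hlast).aestronglyMeasurable.mul hFm)
    · intro x hx hxT
      rw [hf₂]
      simp only [abs_mul]
      refine (mul_le_of_le_one_left (by positivity) (abs_deriv_trapezoid_le T _)).trans ?_
      have h1 := hCc (x (Fin.last d)) (abs_le.1 hxT)
      exact mul_le_mul h1 ((hFn x).trans (h.field_bound x hx)) (abs_nonneg _)
        ((norm_nonneg _).trans h1)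
    · intro x _ hxT
      simp only [hf₂, hθ]
      rw [deriv_trapezoid_eq_zero (Or.inr hxT), zero_mul]
  -- On each cross section the factors other than `Fₙ` are constant, so Fubini and the zero flux
  -- apply.
  have hf₂0 : ∫ x in Ω, f₂ x = 0 := by
    rw [integral_straightCylinder hf₂int]
    have : ∀ t : ℝ, ∫ x' in S, f₂ (axialPoint x' t) = 0 := by
      intro t
      simp only [hf₂, axialPoint_last]
      rw [integral_const_mul, integral_const_mul, h.field_flux t]
      simp
    simp [this]
  have hsum : ∫ x in Ω, θ (x (Fin.last d)) * (u x * F x (Fin.last d)) = ∫ x in Ω, f₁ x := by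
    rw [← add_zero (∫ x in Ω, f₁ x), ← hf₂0, ← integral_add hf₁int hf₂int]
    congr 1
    ext x
    simp only [hf₁, hf₂]
    ring
  rw [hmain, hsum]
  set Q := Ω ∩ {x | |x (Fin.last d)| ∈ Icc T (T + 1)} with hQ
  have hQm : MeasurableSet Q := hΩm.inter (isClosed_Icc.preimage hlast.abs).measurableSet
  have hQ1 : ∫ x in Ω, f₁ x = ∫ x in Q, f₁ x := by
    refine setIntegral_eq_of_subset_of_forall_sdiff_eq_zero hΩm inter_subset_left ?_
    intro x hx
    simp only [hf₁, hθ]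
    rw [deriv_trapezoid_eq_zero, zero_mul]
    by_contra! hcon
    exact hx.2 ⟨hx.1, hcon⟩
  rw [hQ1]
  refine (neg_le_abs _).trans ?_
  have hbound : ∀ᵐ x ∂volume.restrict Q, ‖f₁ x‖ ≤ K * ‖F x‖ :=
    (ae_restrict_iff' hQm).2 (Filter.Eventually.of_forall fun x hx => hf₁le x hx.1)
  refine norm_integral_le_of_norm_le ?_ hbound
  have hfin : IsFiniteMeasure (volume.restrict Q) := ⟨by
    rw [Measure.restrict_apply_univ]
    refine (measure_mono ?_).trans_lt (volume_straightCylinder_inter_lt_top hSb (T + 1))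
    exact fun x hx => ⟨hx.1, hx.2.2⟩⟩
  refine Integrable.of_bound (C := K * M) ?_ ?_
  · refine AEStronglyMeasurable.const_mul ?_ K
    exact ((h.field_contDiffOn.continuousOn.mono inter_subset_left).norm).aestronglyMeasurable hQm
  · refine (ae_restrict_iff' hQm).2 (Filter.Eventually.of_forall fun x hx => ?_)
    rw [norm_mul, norm_norm, Real.norm_of_nonneg hK]
    exact mul_le_mul_of_nonneg_left (h.field_bound x hx.1) hK

/-- If the energy density controls the square of the field, then the energy vanishes. -/
theorem energy_eq_zero (h : IsEnergyPair S F u K M M') (hS : IsOpen S)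
    (hSb : Bornology.IsBounded S) (hSc : Sᶜ.Nonempty) (hSn : S.Nonempty) (hS1 : HasC1Boundary S)
    {R : ℝ} (hR : ∀ x ∈ straightCylinder S, ‖F x‖ ^ 2 ≤ R * fderiv ℝ u x (F x))
    (hpos : ∀ x ∈ straightCylinder S, 0 ≤ fderiv ℝ u x (F x)) :
    ∀ x ∈ straightCylinder S, fderiv ℝ u x (F x) = 0 := by
  set Ω := straightCylinder S with hΩ
  have hΩo : IsOpen Ω := isOpen_straightCylinder hS
  have hΩm := hΩo.measurableSet
  have hlast : Continuous fun x : EuclideanSpace ℝ (Fin (d + 1)) => x (Fin.last d) := by fun_prop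
  set D : EuclideanSpace ℝ (Fin (d + 1)) → ℝ := fun x => fderiv ℝ u x (F x) with hD
  have hDc : ContinuousOn D Ω := h.continuousOn_energy hS
  obtain ⟨a, ha⟩ := hSn
  have hK : 0 ≤ K := (abs_nonneg _).trans (h.osc a ha a ha 0)
  have hM : 0 ≤ M := (norm_nonneg _).trans (h.field_bound (axialPoint a 0) (by simpa [hΩ] using ha))
  -- slabs
  have hmeas : ∀ J : Set ℝ, MeasurableSet J → MeasurableSet (Ω ∩ {x | x (Fin.last d) ∈ J}) :=
    fun J hJ => hΩm.inter (hlast.measurable hJ)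
  have hDint : ∀ T : ℝ, IntegrableOn D (Ω ∩ {x | x (Fin.last d) ∈ {t : ℝ | |t| ≤ T}}) := by
    intro T
    have hJ : MeasurableSet {t : ℝ | |t| ≤ T} := measurableSet_le (by fun_prop) measurable_const
    have hfin : IsFiniteMeasure
        (volume.restrict (Ω ∩ {x | x (Fin.last d) ∈ {t : ℝ | |t| ≤ T}})) := ⟨by
      rw [Measure.restrict_apply_univ]; exact volume_straightCylinder_inter_lt_top hSb T⟩
    refine Integrable.of_bound ((hDc.mono inter_subset_left).aestronglyMeasurable (hmeas _ hJ)) M' ?_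
    exact (ae_restrict_iff' (hmeas _ hJ)).2
      (Filter.Eventually.of_forall fun x hx => h.energy_bound x hx.1)
  -- Half-lengths grow by `2` while the cutoff falls over length `1`, so the closed end slabs `Q k`
  -- lie in `A (k + 1)` and are disjoint from `A k`. The energy in `Q k` is then at most the
  -- increment of `E`.
  set A : ℕ → Set (EuclideanSpace ℝ (Fin (d + 1))) := fun k =>
    Ω ∩ {x | x (Fin.last d) ∈ {t : ℝ | |t| < 2 * k}} with hA
  have hAm : ∀ k, MeasurableSet (A k) := fun k =>
    hmeas _ (measurableSet_lt (by fun_prop) measurable_const)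
  have hAint : ∀ k, IntegrableOn D (A k) := fun k => (hDint (2 * k)).mono_set
    fun x hx => ⟨hx.1, le_of_lt (show |x (Fin.last d)| < 2 * k from hx.2)⟩
  have hAmono : ∀ {j k : ℕ}, j ≤ k → A j ⊆ A k := fun {j k} hjk x hx => by
    have h1 : (j : ℝ) ≤ k := by exact_mod_cast hjk
    have h2 : |x (Fin.last d)| < 2 * j := hx.2
    exact ⟨hx.1, show |x (Fin.last d)| < 2 * k by linarith⟩
  set E : ℕ → ℝ := fun k => ∫ x in A k, D x with hE
  have hEmono : Monotone E := fun j k hjk =>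
    setIntegral_mono_set (hAint k) ((ae_restrict_iff' (hAm k)).2
      (Filter.Eventually.of_forall fun x hx => hpos x hx.1)) (hAmono hjk).eventuallyLE
  set Q : ℕ → Set (EuclideanSpace ℝ (Fin (d + 1))) := fun k =>
    Ω ∩ {x | |x (Fin.last d)| ∈ Icc (2 * k : ℝ) (2 * k + 1)} with hQ
  have hQm : ∀ k, MeasurableSet (Q k) := fun k =>
    hΩm.inter (isClosed_Icc.preimage hlast.abs).measurableSet
  obtain ⟨V, hV0, hV⟩ : ∃ V : ℝ, 0 ≤ V ∧ ∀ k, volume (Q k) < ⊤ ∧ volume.real (Q k) ≤ V := by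
    have hW : volume S * 2 ≠ ⊤ := ENNReal.mul_ne_top hSb.measure_lt_top.ne (by norm_num)
    refine ⟨(volume S * 2).toReal, ENNReal.toReal_nonneg, fun k => ?_⟩
    have h1 : Q k = Ω ∩ {x | x (Fin.last d) ∈
        {t : ℝ | |t| ∈ Icc (2 * k : ℝ) (2 * k + 1)}} := rfl
    have h2 : volume {t : ℝ | |t| ∈ Icc (2 * k : ℝ) (2 * k + 1)} ≤ 2 := by
      have hsub : {t : ℝ | |t| ∈ Icc (2 * k : ℝ) (2 * k + 1)} ⊆
          Icc (2 * k : ℝ) (2 * k + 1) ∪ Icc (-(2 * k + 1) : ℝ) (-(2 * k)) := by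
        intro t ht
        rcases abs_cases t with ⟨h1, _⟩ | ⟨h1, _⟩
        · left; have := ht.1; have := ht.2; constructor <;> linarith
        · right; have := ht.1; have := ht.2; constructor <;> linarith
      refine (measure_mono hsub).trans ((measure_union_le _ _).trans ?_)
      rw [Real.volume_Icc, Real.volume_Icc]
      ring_nf
      norm_num
    have h3 : volume (Q k) ≤ volume S * 2 := by
      rw [h1, hΩ, volume_straightCylinder_inter]
      gcongr
    exact ⟨h3.trans_lt hW.lt_top, ENNReal.toReal_mono hW h3⟩
  have hQint : ∀ k, IntegrableOn D (Q k) := fun k => (hDint (2 * k + 1)).mono_set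
    fun x hx => ⟨hx.1, hx.2.2⟩
  have hQD : ∀ k, ∫ x in Q k, D x ≤ E (k + 1) - E k := by
    intro k
    have h1 : E (k + 1) = E k + ∫ x in A (k + 1) \ A k, D x := by
      rw [setIntegral_sdiff (hAm k) (hAint (k + 1)) (hAmono (Nat.le_succ k))]
      ring
    rw [h1, add_sub_cancel_left]
    refine setIntegral_mono_set ((hAint (k + 1)).mono_set sdiff_subset)
      ((ae_restrict_iff' ((hAm _).diff (hAm _))).2
        (Filter.Eventually.of_forall fun x hx => hpos x hx.1.1)) (LE.le.eventuallyLE ?_)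
    intro x hx
    refine ⟨⟨hx.1, ?_⟩, fun hcon => ?_⟩
    · have := hx.2.2
      show |x (Fin.last d)| < 2 * ((k + 1 : ℕ) : ℝ)
      push_cast
      linarith
    · have h2 : |x (Fin.last d)| < 2 * k := hcon.2
      exact absurd hx.2.1 (not_le.2 h2)
  have hEle : ∀ k, E k ≤ ∫ x in Q k, K * ‖F x‖ := by
    intro k
    refine le_trans ?_ (h.integral_trapezoid_mul_le hS hSb hSc ⟨a, ha⟩ hS1 (2 * k))
    have h1 : E k = ∫ x in A k, trapezoid (2 * k) (x (Fin.last d)) * D x :=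
      setIntegral_congr_fun (hAm k) fun x hx => by
        have : |x (Fin.last d)| < 2 * k := hx.2
        simp only
        rw [trapezoid_eq_one this.le, one_mul]
    rw [h1]
    refine setIntegral_mono_set ?_ ((ae_restrict_iff' hΩm).2
      (Filter.Eventually.of_forall fun x hx => mul_nonneg (clampUnit_nonneg _) (hpos x hx)))
      (LE.le.eventuallyLE fun x hx => hx.1)
    refine integrableOn_straightCylinder_of_bounded hS hSb (M := M') (T := 2 * k + 1) ?_ ?_ ?_
    · exact ((lipschitzWith_trapezoid _).continuous.comp hlast).aestronglyMeasurable.mul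
        (hDc.aestronglyMeasurable hΩm)
    · intro x hx _
      rw [abs_mul]
      exact (mul_le_of_le_one_left (abs_nonneg _) (abs_clampUnit_le_one _)).trans
        (h.energy_bound x hx)
    · intro x _ hxT
      rw [trapezoid_eq_zero hxT.le, zero_mul]
  have hFint : ∀ k, IntegrableOn (fun x => K * ‖F x‖) (Q k) := by
    intro k
    have hfin : IsFiniteMeasure (volume.restrict (Q k)) := ⟨by
      rw [Measure.restrict_apply_univ]; exact (hV k).1⟩
    refine Integrable.of_bound (C := K * M) ?_ ?_
    · refine AEStronglyMeasurable.const_mul ?_ K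
      exact ((h.field_contDiffOn.continuousOn.mono
        inter_subset_left).norm).aestronglyMeasurable (hQm k)
    · refine (ae_restrict_iff' (hQm k)).2 (Filter.Eventually.of_forall fun x hx => ?_)
      rw [norm_mul, norm_norm, Real.norm_of_nonneg hK]
      exact mul_le_mul_of_nonneg_left (h.field_bound x hx.1) hK
  have hconst : ∀ (k : ℕ) (c : ℝ), IntegrableOn (fun _ => c) (Q k) := fun k c =>
    integrableOn_const (hV k).1.ne
  have hbdd : BddAbove (range E) := by
    refine ⟨V * (K * M), ?_⟩
    rintro _ ⟨k, rfl⟩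
    refine (hEle k).trans ?_
    have h1 : ∫ x in Q k, K * ‖F x‖ ≤ ∫ x in Q k, K * M :=
      setIntegral_mono_on (hFint k) (hconst k _) (hQm k) fun x hx =>
        mul_le_mul_of_nonneg_left (h.field_bound x hx.1) hK
    refine h1.trans ?_
    rw [setIntegral_const, smul_eq_mul]
    exact mul_le_mul_of_nonneg_right (hV k).2 (mul_nonneg hK hM)
  -- Young's inequality and `|F|² ≤ R D` give `|F| ≤ lam + |R| D / lam`, which is integrated over
  -- the end slabs, of volume at most `V` for every `k`.
  have hincr : ∀ lam, 0 < lam → ∀ k,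
      E k ≤ lam * (K * V) + (K * |R|) / lam * (E (k + 1) - E k) := by
    intro lam hlam k
    have hpt : ∀ x ∈ Q k, K * ‖F x‖ ≤ K * lam + K * |R| / lam * D x := by
      intro x hx
      have h1 : ‖F x‖ ≤ lam + |R| / lam * D x := by
        have h2 := hR x hx.1
        have h3 := hpos x hx.1
        have h4 : R * D x ≤ |R| * D x := mul_le_mul_of_nonneg_right (le_abs_self R) h3
        have h5 : ‖F x‖ * lam ≤ lam ^ 2 + |R| * D x := by nlinarith [sq_nonneg (‖F x‖ - lam)]
        rw [div_mul_eq_mul_div, ← sub_le_iff_le_add', le_div_iff₀ hlam]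
        linarith
      calc K * ‖F x‖ ≤ K * (lam + |R| / lam * D x) := mul_le_mul_of_nonneg_left h1 hK
        _ = _ := by ring
    have h1 : ∫ x in Q k, K * ‖F x‖ ≤ ∫ x in Q k, (K * lam + K * |R| / lam * D x) :=
      setIntegral_mono_on (hFint k) ((hconst k _).add ((hQint k).const_mul _)) (hQm k) hpt
    refine (hEle k).trans (h1.trans ?_)
    rw [integral_add (hconst k _) ((hQint k).const_mul _), setIntegral_const, integral_const_mul,
      smul_eq_mul]
    refine add_le_add ?_ (mul_le_mul_of_nonneg_left (hQD k) (by positivity))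
    calc volume.real (Q k) * (K * lam) ≤ V * (K * lam) :=
          mul_le_mul_of_nonneg_right (hV k).2 (by positivity)
      _ = _ := by ring
  have hE0 : ∀ k, E k = 0 := fun k => le_antisymm (nonpos_of_le_increment hEmono hbdd hincr k)
    (setIntegral_nonneg (hAm k) fun x hx => hpos x hx.1)
  intro x hx
  obtain ⟨k, hk⟩ := exists_nat_gt |x (Fin.last d)|
  have hxk : x ∈ A k := ⟨hx, show |x (Fin.last d)| < 2 * k by
    have : (0 : ℝ) ≤ k := Nat.cast_nonneg k
    linarith⟩
  -- The strict inequality in `A k` makes it open, so by continuity the energy density vanishes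
  -- everywhere on it and not only almost everywhere.
  have hAo : IsOpen (A k) := hΩo.inter (isOpen_Iio.preimage hlast.abs)
  have h1 : D =ᵐ[volume.restrict (A k)] 0 :=
    (setIntegral_eq_zero_iff_of_nonneg_ae ((ae_restrict_iff' (hAm k)).2
      (Filter.Eventually.of_forall fun x hx => hpos x hx.1)) (hAint k)).1 (hE0 k)
  exact Measure.eqOn_open_of_ae_eq h1 hAo (hDc.mono inter_subset_left) continuousOn_const hxk

end IsEnergyPair

/-! ### The mass flux -/

/-- The mass flux density `ρ(|v|²) v` of a flow with velocity `v`. -/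
noncomputable def fluxField {n : ℕ} (p : ℝ → ℝ) (B : ℝ) (v : EuclideanSpace ℝ (Fin n)) :
    EuclideanSpace ℝ (Fin n) :=
  density p B (‖v‖ ^ 2) • v

/-- Positivity of the density turns the norm of the flux into the scalar function of the speed whose
monotonicity is known. -/
theorem IsCriticalSpeed.norm_fluxField {p : ℝ → ℝ} {B qcr : ℝ} (h : IsCriticalSpeed p B qcr)
    {n : ℕ} {v : EuclideanSpace ℝ (Fin n)} (hv : ‖v‖ ≤ qcr) :
    ‖fluxField p B v‖ = density p B (‖v‖ ^ 2) * ‖v‖ := by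
  rw [fluxField, norm_smul, Real.norm_of_nonneg (h.density_pos _ ⟨norm_nonneg v, hv⟩).le]

/-- The mass flux is cocoercive on the closed ball of subsonic velocities. -/
theorem IsCriticalSpeed.cocoercive {p : ℝ → ℝ} {B qcr : ℝ} (h : IsCriticalSpeed p B qcr) {n : ℕ}
    {v w : EuclideanSpace ℝ (Fin n)} (hv : ‖v‖ ≤ qcr) (hw : ‖w‖ ≤ qcr) :
    ‖fluxField p B v - fluxField p B w‖ ^ 2 ≤
      density p B 0 * inner ℝ (fluxField p B v - fluxField p B w) (v - w) := by
  have hva : ‖v‖ ∈ Icc 0 qcr := ⟨norm_nonneg v, hv⟩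
  have hwa : ‖w‖ ∈ Icc 0 qcr := ⟨norm_nonneg w, hw⟩
  have h0 : (0 : ℝ) ∈ Icc 0 qcr := ⟨le_rfl, h.pos.le⟩
  set a := ‖v‖ with ha
  set b := ‖w‖ with hb
  set s := density p B (a ^ 2) with hs
  set r := density p B (b ^ 2) with hr
  set R := density p B 0 with hR
  have hs0 : 0 < s := h.density_pos a hva
  have hr0 : 0 < r := h.density_pos b hwa
  have hsR : s ≤ R := by
    have := h.density_anti h0 hva hva.1
    simpa using this
  have hrR : r ≤ R := by
    have := h.density_anti h0 hwa hwa.1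
    simpa using this
  set I : ℝ := inner ℝ v w with hI
  have hIab : I ≤ a * b := real_inner_le_norm v w
  have e1 : ‖fluxField p B v - fluxField p B w‖ ^ 2 =
      s ^ 2 * a ^ 2 + r ^ 2 * b ^ 2 - 2 * (s * r * I) := by
    rw [fluxField, fluxField, norm_sub_sq_real, norm_smul, norm_smul, inner_smul_left,
      inner_smul_right, mul_pow, mul_pow]
    simp only [Real.norm_eq_abs, sq_abs, conj_trivial]
    ring
  have e2 : inner ℝ (fluxField p B v - fluxField p B w) (v - w) =
      s * a ^ 2 + r * b ^ 2 - (s + r) * I := by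
    rw [fluxField, fluxField, inner_sub_left, inner_sub_right, inner_sub_right]
    simp only [inner_smul_left, conj_trivial, real_inner_self_eq_norm_sq]
    rw [real_inner_comm v w]
    ring
  rw [e1, e2]
  -- The case of parallel velocities. If `b ≤ a`, then `s ≤ r`, so `s a - r b ≤ s (a - b) ≤ R (a -
  -- b)`; multiplication by `s a - r b ≥ 0`, which is monotonicity of the flux, gives the claim.
  have hmul : (s * a - r * b) ^ 2 ≤ R * ((s * a - r * b) * (a - b)) := by
    have hmono := h.flux_strictMono.monotoneOn
    rcases le_total b a with hab | hab
    · have h1 : r * b ≤ s * a := hmono hwa hva hab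
      have h2 : s ≤ r := h.density_anti hwa hva hab
      have h3 : s * a - r * b ≤ R * (a - b) := by nlinarith [hwa.1]
      nlinarith
    · have h1 : s * a ≤ r * b := hmono hva hwa hab
      have h2 : r ≤ s := h.density_anti hva hwa hab
      have h3 : r * b - s * a ≤ R * (b - a) := by nlinarith [hva.1]
      nlinarith
  -- The two sides differ from the parallel case by `2 s r (a b - I)` on the left and `R (s + r)(a b
  -- - I)` on the right; `a b - I ≥ 0` by Cauchy–Schwarz, and `s, r ≤ R`.
  have hcoef : 0 ≤ R * (s + r) - 2 * (s * r) := by nlinarith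
  nlinarith [mul_nonneg hcoef (sub_nonneg.2 hIab)]

theorem IsCriticalSpeed.density_zero_pos {p : ℝ → ℝ} {B qcr : ℝ} (h : IsCriticalSpeed p B qcr) :
    0 < density p B 0 := by
  simpa using h.density_pos 0 ⟨le_rfl, h.pos.le⟩

/-- Strict monotonicity of the flux recovers the speed; the common positive density can then be
cancelled. -/
theorem IsCriticalSpeed.fluxField_injOn {p : ℝ → ℝ} {B qcr : ℝ} (h : IsCriticalSpeed p B qcr)
    {n : ℕ} {v w : EuclideanSpace ℝ (Fin n)} (hv : ‖v‖ ≤ qcr) (hw : ‖w‖ ≤ qcr)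
    (heq : fluxField p B v = fluxField p B w) : v = w := by
  have hn : ‖v‖ = ‖w‖ := by
    refine h.flux_strictMono.injOn ⟨norm_nonneg v, hv⟩ ⟨norm_nonneg w, hw⟩ ?_
    rw [← h.norm_fluxField hv, ← h.norm_fluxField hw, heq]
  rw [fluxField, fluxField, hn] at heq
  exact smul_right_injective _ (h.density_pos _ ⟨norm_nonneg w, hw⟩).ne' heq

theorem IsCriticalSpeed.norm_fluxField_le {p : ℝ → ℝ} {B qcr : ℝ} (h : IsCriticalSpeed p B qcr)
    {n : ℕ} {v : EuclideanSpace ℝ (Fin n)} (hv : ‖v‖ ≤ qcr) :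
    ‖fluxField p B v‖ ≤ density p B (qcr ^ 2) * qcr := by
  rw [h.norm_fluxField hv]
  exact h.flux_strictMono.monotoneOn ⟨norm_nonneg v, hv⟩ ⟨h.pos.le, le_rfl⟩ hv

theorem IsCriticalSpeed.norm_fluxField_lt {p : ℝ → ℝ} {B qcr : ℝ} (h : IsCriticalSpeed p B qcr)
    {n : ℕ} {v : EuclideanSpace ℝ (Fin n)} (hv : ‖v‖ < qcr) :
    ‖fluxField p B v‖ < density p B (qcr ^ 2) * qcr := by
  rw [h.norm_fluxField hv.le]
  exact h.flux_strictMono ⟨norm_nonneg v, hv.le⟩ ⟨h.pos.le, le_rfl⟩ hv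

theorem IsCriticalSpeed.contDiffAt_fluxField {p : ℝ → ℝ} {B qcr : ℝ} (h : IsCriticalSpeed p B qcr)
    {n : ℕ} {v : EuclideanSpace ℝ (Fin n)} (hv : ‖v‖ ≤ qcr) :
    ContDiffAt ℝ 1 (fluxField p B) v := by
  have hρ : ContDiffAt ℝ 1 (fun v : EuclideanSpace ℝ (Fin n) => density p B (‖v‖ ^ 2)) v :=
    ContDiffAt.comp (f := fun v : EuclideanSpace ℝ (Fin n) => ‖v‖ ^ 2) v
    (h.contDiffAt _ ⟨norm_nonneg v, hv⟩) (contDiff_norm_sq ℝ).contDiffAt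
  exact hρ.smul (contDiffAt_id (x := v))

/-! ### Nozzle flows -/

theorem contDiffOn_gradient {n : ℕ} {Ω : Set (EuclideanSpace ℝ (Fin n))} (hΩ : IsOpen Ω)
    {φ : EuclideanSpace ℝ (Fin n) → ℝ} (hφ : ContDiffOn ℝ 2 φ Ω) :
    ContDiffOn ℝ 1 (gradient φ) Ω :=
  (InnerProductSpace.toDual ℝ (EuclideanSpace ℝ (Fin n))).symm.contDiff.comp_contDiffOn
    (hφ.fderiv_of_isOpen hΩ (by norm_num))

theorem IsNozzleFlow.norm_gradient_lt {d : ℕ} {p : ℝ → ℝ} {B qcr m₀ : ℝ}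
    (hq : IsCriticalSpeed p B qcr) {Ω : Set (EuclideanSpace ℝ (Fin (d + 1)))}
    {φ : EuclideanSpace ℝ (Fin (d + 1)) → ℝ} (hφ : IsNozzleFlow p B Ω m₀ φ)
    {x : EuclideanSpace ℝ (Fin (d + 1))} (hx : x ∈ Ω) : ‖gradient φ x‖ < qcr :=
  (hq.subsonic_iff _ (norm_nonneg _)).1 (hφ.subsonic x hx)

theorem IsNozzleFlow.integral_flux {d : ℕ} {p : ℝ → ℝ} {B m₀ : ℝ}
    {S : Set (EuclideanSpace ℝ (Fin d))}
    {φ : EuclideanSpace ℝ (Fin (d + 1)) → ℝ} (hφ : IsNozzleFlow p B (straightCylinder S) m₀ φ)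
    (t : ℝ) : ∫ x' in S, (massFlux p B φ (axialPoint x' t)) (Fin.last d) = m₀ := by
  have := hφ.flux t
  simpa using this

theorem IsNozzleFlow.integrableOn_flux {d : ℕ} {p : ℝ → ℝ} {B qcr m₀ : ℝ}
    (hq : IsCriticalSpeed p B qcr) {S : Set (EuclideanSpace ℝ (Fin d))} (hS : IsOpen S)
    (hSb : Bornology.IsBounded S) {φ : EuclideanSpace ℝ (Fin (d + 1)) → ℝ}
    (hφ : IsNozzleFlow p B (straightCylinder S) m₀ φ) (t : ℝ) :
    IntegrableOn (fun x' => (massFlux p B φ (axialPoint x' t)) (Fin.last d)) S := by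
  have hΩo := isOpen_straightCylinder hS
  have hg := contDiffOn_gradient hΩo hφ.contDiffOn
  have hc : ContinuousOn (massFlux p B φ) (straightCylinder S) := by
    intro x hx
    have h1 : ContinuousAt (fluxField p B) (gradient φ x) :=
      (hq.contDiffAt_fluxField (hφ.norm_gradient_lt hq hx).le).continuousAt
    exact ContinuousAt.comp_continuousWithinAt (f := gradient φ) h1 (hg.continuousOn x hx)
  have hc2 : ContinuousOn (fun x' => (massFlux p B φ (axialPoint x' t)) (Fin.last d)) S := by
    have h1 : ContinuousOn (fun x' => massFlux p B φ (axialPoint x' t)) S :=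
      hc.comp (continuous_axialPoint.comp
        (by fun_prop : Continuous fun x' : EuclideanSpace ℝ (Fin d) => (x', t))).continuousOn
        (fun x' hx' => by simpa using hx')
    have h2 : Continuous fun y : EuclideanSpace ℝ (Fin (d + 1)) => y (Fin.last d) := by fun_prop
    exact h2.comp_continuousOn h1
  have hfin : IsFiniteMeasure (volume.restrict S) :=
    ⟨by rw [Measure.restrict_apply_univ]; exact hSb.measure_lt_top⟩
  refine Integrable.of_bound (C := density p B (qcr ^ 2) * qcr)
    (hc2.aestronglyMeasurable hS.measurableSet) ?_
  refine (ae_restrict_iff' hS.measurableSet).2 (Filter.Eventually.of_forall fun x' hx' => ?_)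
  exact (PiLp.norm_apply_le _ _).trans
    (hq.norm_fluxField_le (hφ.norm_gradient_lt hq (by simpa using hx')).le)

/-- The flux density is strictly below its sonic value at every point of the section, and `S` has
positive measure, so the integral inequality is strict. This excludes equality in the nonexistence
part. -/
theorem IsNozzleFlow.flux_lt {d : ℕ} {p : ℝ → ℝ} {B qcr m₀ : ℝ}
    (hq : IsCriticalSpeed p B qcr) {S : Set (EuclideanSpace ℝ (Fin d))} (hS : IsOpen S)
    (hSb : Bornology.IsBounded S) (hSn : S.Nonempty) {φ : EuclideanSpace ℝ (Fin (d + 1)) → ℝ}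
    (hφ : IsNozzleFlow p B (straightCylinder S) m₀ φ) :
    m₀ < density p B (qcr ^ 2) * qcr * volume.real S := by
  set c := density p B (qcr ^ 2) * qcr with hc
  have hint := hφ.integrableOn_flux hq hS hSb 0
  have hconst : IntegrableOn (fun _ : EuclideanSpace ℝ (Fin d) => c) S :=
    integrableOn_const hSb.measure_lt_top.ne
  have hlt : ∀ x' ∈ S, 0 < c - (massFlux p B φ (axialPoint x' 0)) (Fin.last d) := by
    intro x' hx'
    have h1 := (le_abs_self _).trans (PiLp.norm_apply_le (massFlux p B φ (axialPoint x' 0))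
      (Fin.last d))
    have h2 := hq.norm_fluxField_lt (hφ.norm_gradient_lt hq
      (show axialPoint x' 0 ∈ straightCylinder S by simpa using hx'))
    have h3 : ‖massFlux p B φ (axialPoint x' 0)‖ < c := h2
    linarith
  have hpos : 0 < ∫ x' in S, (c - (massFlux p B φ (axialPoint x' 0)) (Fin.last d)) := by
    rw [setIntegral_pos_iff_support_of_nonneg_ae ((ae_restrict_iff' hS.measurableSet).2
      (Filter.Eventually.of_forall fun x hx => (hlt x hx).le)) (hconst.sub hint)]
    have hsub : Function.support
        (fun x' => c - (massFlux p B φ (axialPoint x' 0)) (Fin.last d)) ∩ S = S :=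
      inter_eq_right.2 fun x hx => (hlt x hx).ne'
    rw [hsub]
    exact hS.measure_pos volume hSn
  rw [integral_sub hconst hint, hφ.integral_flux 0, setIntegral_const, smul_eq_mul] at hpos
  linarith

/-- A nozzle flow in a straight cylinder with the mass flux of a uniform flow is that flow. -/
theorem IsNozzleFlow.gradient_eq {d : ℕ} {p : ℝ → ℝ} {B qcr m₀ q₀ : ℝ}
    (hq : IsCriticalSpeed p B qcr) {S : Set (EuclideanSpace ℝ (Fin d))} (hS : IsOpen S)
    (hSb : Bornology.IsBounded S) (hSc : Sᶜ.Nonempty) (hSn : S.Nonempty)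
    (hSp : IsPreconnected S) (hS1 : HasC1Boundary S) (hq₀ : q₀ ∈ Icc 0 qcr)
    (hm : density p B (q₀ ^ 2) * q₀ * volume.real S = m₀)
    {φ : EuclideanSpace ℝ (Fin (d + 1)) → ℝ}
    (hφ : IsNozzleFlow p B (straightCylinder S) m₀ φ) :
    ∀ x ∈ straightCylinder S, gradient φ x = q₀ • EuclideanSpace.single (Fin.last d) (1 : ℝ) := by
  set Ω := straightCylinder S with hΩ
  have hΩo : IsOpen Ω := isOpen_straightCylinder hS
  set e : EuclideanSpace ℝ (Fin (d + 1)) := EuclideanSpace.single (Fin.last d) (1 : ℝ) with he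
  set w := q₀ • e with hw
  have hwn : ‖w‖ = q₀ := by
    rw [hw, norm_smul, he]
    simp [abs_of_nonneg hq₀.1]
  have hwq : ‖w‖ ≤ qcr := hwn ▸ hq₀.2
  obtain ⟨G, hGc, hGφ, hGν⟩ := hφ.slip
  have hGlt : ∀ x ∈ Ω, ‖G x‖ < qcr := fun x hx => by
    rw [hGφ hx]; exact hφ.norm_gradient_lt hq hx
  -- On the boundary the speed may be sonic; the flux map is still `C¹` there, so `F` is continuous
  -- on the closure.
  have hGle : ∀ x ∈ closure Ω, ‖G x‖ ≤ qcr := fun x hx =>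
    le_on_closure (fun y hy => (hGlt y hy).le) hGc.norm continuousOn_const hx
  set F : EuclideanSpace ℝ (Fin (d + 1)) → EuclideanSpace ℝ (Fin (d + 1)) := fun x =>
    fluxField p B (G x) - fluxField p B w with hF
  set u : EuclideanSpace ℝ (Fin (d + 1)) → ℝ := fun x => φ x - q₀ * x (Fin.last d) with hu
  set c := density p B (qcr ^ 2) * qcr with hc
  have hFle : ∀ x ∈ Ω, ‖F x‖ ≤ c + c := fun x hx => (norm_sub_le _ _).trans
    (add_le_add (hq.norm_fluxField_le (hGlt x hx).le) (hq.norm_fluxField_le hwq))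
  have hφd : ∀ x ∈ Ω, DifferentiableAt ℝ φ x := fun x hx =>
    (hφ.contDiffOn.contDiffAt (hΩo.mem_nhds hx)).differentiableAt two_ne_zero
  have hφG : ∀ x ∈ Ω, ∀ v, fderiv ℝ φ x v = inner ℝ (G x) v := fun x hx v => by
    rw [hGφ hx, inner_gradient_left]
  have hud : ∀ x ∈ Ω, ∀ v, fderiv ℝ u x v = inner ℝ (G x - w) v := by
    intro x hx v
    set π : EuclideanSpace ℝ (Fin (d + 1)) →L[ℝ] ℝ := EuclideanSpace.proj (Fin.last d) with hπ
    have h1 : HasFDerivAt u (fderiv ℝ φ x - q₀ • π) x :=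
      (hφd x hx).hasFDerivAt.sub (π.hasFDerivAt.const_mul q₀)
    rw [h1.fderiv, inner_sub_left, ← hφG x hx v, hw, inner_smul_left, he,
      EuclideanSpace.inner_single_left]
    simp [hπ]
  have hG1 : ContDiffOn ℝ 1 G Ω := (contDiffOn_gradient hΩo hφ.contDiffOn).congr hGφ
  have hF1 : ContDiffOn ℝ 1 F Ω := by
    intro x hx
    refine ContDiffWithinAt.sub ?_ contDiffWithinAt_const
    exact ContDiffAt.comp_contDiffWithinAt (g := fluxField p B) x (hq.contDiffAt_fluxField (hGlt x hx).le) (hG1 x hx)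
  -- Applied to the restrictions of `φ` to cross sections; subtracting `q₀ xₙ` does not change
  -- differences within a section.
  obtain ⟨K, hK⟩ := hS1.exists_osc_bound hS hSb hSp qcr
  have hφS : ∀ t : ℝ, HasGradientBound S qcr fun x' => φ (axialPoint x' t) := by
    intro t x' hx'
    have hxΩ : axialPoint x' t ∈ Ω := by simpa [hΩ] using hx'
    have h1 : HasFDerivAt (fun y' : EuclideanSpace ℝ (Fin d) => axialEquiv d (y', t))
        ((axialEquiv d).toContinuousLinearMap.comp
          (ContinuousLinearMap.inl ℝ (EuclideanSpace ℝ (Fin d)) ℝ)) x' :=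
      (axialEquiv d).hasFDerivAt.comp x' (hasFDerivAt_prodMk_left x' t)
    have h2 : HasFDerivAt (fun y' => φ (axialPoint y' t)) _ x' :=
      HasFDerivAt.comp (g := φ) x' (hφd _ hxΩ).hasFDerivAt h1
    refine ⟨h2.differentiableAt, ?_⟩
    rw [h2.fderiv]
    refine ContinuousLinearMap.opNorm_le_bound _ hq.pos.le fun v => ?_
    have h3 : fderiv ℝ φ (axialPoint x' t) (axialPoint v 0) =
        inner ℝ (G (axialPoint x' t)) (axialPoint v 0) := hφG _ hxΩ _
    have h4 : ‖fderiv ℝ φ (axialPoint x' t) (axialPoint v 0)‖ ≤ qcr * ‖v‖ := by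
      rw [h3]
      refine (norm_inner_le_norm _ _).trans ?_
      exact mul_le_mul (hGlt _ hxΩ).le (norm_axialPoint_zero_le v) (norm_nonneg _) hq.pos.le
    exact h4
  have hpair : IsEnergyPair S F u K (c + c) ((qcr + qcr) * (c + c)) := by
    refine ⟨hF1, ?_, ?_, hFle, ?_, ?_, ?_, ?_, ?_, ?_⟩
    · intro x hx
      refine ContinuousWithinAt.sub ?_ continuousWithinAt_const
      exact ContinuousAt.comp_continuousWithinAt (f := G)
        (hq.contDiffAt_fluxField (hGle x hx)).continuousAt (hGc x hx)
    · intro x hx ν hν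
      have h1 := hGν x hx ν hν
      have h2 := hν.apply_last_eq_zero hS hx
      simp only [hF, fluxField]
      rw [inner_sub_left, inner_smul_left, inner_smul_left, h1, hw, inner_smul_left, he,
        EuclideanSpace.inner_single_left, h2]
      simp
    · intro x hx
      have h1 : F =ᶠ[𝓝 x] fun y => massFlux p B φ y - fluxField p B w := by
        filter_upwards [hΩo.mem_nhds hx] with y hy
        simp only [hF]
        rw [hGφ hy]
        rfl
      have h2 := hφ.potential_eq x hx
      rw [divergence] at h2 ⊢
      rw [h1.fderiv_eq, fderiv_sub_const]
      exact h2
    · intro t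
      have h1 : ∀ x' ∈ S, F (axialPoint x' t) (Fin.last d) =
          (massFlux p B φ (axialPoint x' t)) (Fin.last d) - density p B (q₀ ^ 2) * q₀ := by
        intro x' hx'
        have hxΩ : axialPoint x' t ∈ Ω := by simpa [hΩ] using hx'
        simp only [hF]
        rw [hGφ hxΩ]
        simp only [fluxField, massFlux, hwn]
        simp [hw, he]
      have hconst : IntegrableOn
          (fun _ : EuclideanSpace ℝ (Fin d) => density p B (q₀ ^ 2) * q₀) S :=
        integrableOn_const hSb.measure_lt_top.ne
      rw [setIntegral_congr_fun hS.measurableSet h1,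
        integral_sub (hφ.integrableOn_flux hq hS hSb t) hconst, hφ.integral_flux t,
        setIntegral_const, smul_eq_mul, ← hm]
      ring
    · exact (hφ.contDiffOn.of_le (by norm_num)).sub (ContDiff.contDiffOn (by fun_prop))
    · exact hφ.continuousOn.sub (Continuous.continuousOn (by fun_prop))
    · intro x hx y hy t
      have h1 := hK _ (hφS t) x hx y hy
      simpa [hu] using h1
    · intro x hx
      rw [hud x hx]
      refine (abs_real_inner_le_norm _ _).trans ?_
      exact mul_le_mul ((norm_sub_le _ _).trans (add_le_add (hGlt x hx).le hwq)) (hFle x hx)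
        (norm_nonneg _) (by linarith [hq.pos])
  have hcoc : ∀ x ∈ Ω, ‖F x‖ ^ 2 ≤ density p B 0 * fderiv ℝ u x (F x) := by
    intro x hx
    rw [hud x hx, real_inner_comm]
    exact hq.cocoercive (hGlt x hx).le hwq
  -- Cocoercivity supplies both requirements: control of `|F|²` and, as `ρ(0) > 0`, nonnegativity of
  -- the energy density.
  have hzero := hpair.energy_eq_zero hS hSb hSc hSn hS1 hcoc fun x hx => by
    have h1 := (sq_nonneg _).trans (hcoc x hx)
    exact nonneg_of_mul_nonneg_right h1 hq.density_zero_pos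
  intro x hx
  have h1 := hcoc x hx
  rw [hzero x hx, mul_zero] at h1
  have h2 : F x = 0 := by
    rw [← norm_eq_zero]
    exact pow_eq_zero_iff two_ne_zero |>.1 (le_antisymm h1 (sq_nonneg _))
  rw [← hGφ hx]
  exact hq.fluxField_injOn (hGlt x hx).le hwq (sub_eq_zero.1 h2)

/-! ### Uniform flows -/

/-- The potential of a uniform flow has the axial velocity as gradient. -/
theorem hasGradientAt_uniform {d : ℕ} (q₀ φ₀ : ℝ) (x : EuclideanSpace ℝ (Fin (d + 1))) :
    HasGradientAt (fun x : EuclideanSpace ℝ (Fin (d + 1)) => q₀ * x (Fin.last d) + φ₀)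
      (q₀ • EuclideanSpace.single (Fin.last d) (1 : ℝ)) x := by
  set π : EuclideanSpace ℝ (Fin (d + 1)) →L[ℝ] ℝ := EuclideanSpace.proj (Fin.last d) with hπ
  have h1 : HasFDerivAt (fun x : EuclideanSpace ℝ (Fin (d + 1)) => q₀ * x (Fin.last d) + φ₀)
      (q₀ • π) x := (π.hasFDerivAt.const_mul q₀).add_const φ₀
  rw [hasGradientAt_iff_hasFDerivAt]
  convert! h1 using 1
  ext v
  rw [InnerProductSpace.toDual_apply_apply, inner_smul_left, EuclideanSpace.inner_single_left]
  simp [hπ]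

theorem gradient_eq_of_eqOn_uniform {d : ℕ} {Ω : Set (EuclideanSpace ℝ (Fin (d + 1)))}
    (hΩ : IsOpen Ω) {φ : EuclideanSpace ℝ (Fin (d + 1)) → ℝ} {q₀ φ₀ : ℝ}
    (h : ∀ x ∈ Ω, φ x = q₀ * x (Fin.last d) + φ₀) {x : EuclideanSpace ℝ (Fin (d + 1))}
    (hx : x ∈ Ω) : gradient φ x = q₀ • EuclideanSpace.single (Fin.last d) (1 : ℝ) := by
  refine ((hasGradientAt_uniform q₀ φ₀ x).congr_of_eventuallyEq ?_).gradient
  filter_upwards [hΩ.mem_nhds hx] with y hy using h y hy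

/-- The flux field is constant, hence divergence free, and the slip condition holds since normals
have no axial component. -/
theorem isNozzleFlow_uniform {d : ℕ} {p : ℝ → ℝ} {B qcr m₀ q₀ : ℝ}
    (hq : IsCriticalSpeed p B qcr) {S : Set (EuclideanSpace ℝ (Fin d))} (hS : IsOpen S)
    (hq₀ : 0 ≤ q₀) (hq₀' : q₀ < qcr) (hm : density p B (q₀ ^ 2) * q₀ * volume.real S = m₀)
    {φ : EuclideanSpace ℝ (Fin (d + 1)) → ℝ} {φ₀ : ℝ}
    (h : ∀ x ∈ closure (straightCylinder S), φ x = q₀ * x (Fin.last d) + φ₀) :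
    IsNozzleFlow p B (straightCylinder S) m₀ φ := by
  set Ω := straightCylinder S with hΩ
  have hΩo : IsOpen Ω := isOpen_straightCylinder hS
  set w : EuclideanSpace ℝ (Fin (d + 1)) := q₀ • EuclideanSpace.single (Fin.last d) (1 : ℝ) with hw
  have hwn : ‖w‖ = q₀ := by
    rw [hw, norm_smul]
    simp [abs_of_nonneg hq₀]
  have hgrad : ∀ x ∈ Ω, gradient φ x = w := fun x hx =>
    gradient_eq_of_eqOn_uniform hΩo (fun y hy => h y (subset_closure hy)) hx
  have hflux : ∀ x ∈ Ω, massFlux p B φ x = density p B (q₀ ^ 2) • w := fun x hx => by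
    rw [massFlux, hgrad x hx, hwn]
  refine ⟨?_, ?_, ?_, ⟨fun _ => w, continuousOn_const, fun x hx => (hgrad x hx).symm, ?_⟩, ?_, ?_⟩
  · refine ContDiffOn.congr (f := fun x : EuclideanSpace ℝ (Fin (d + 1)) =>
      q₀ * x (Fin.last d) + φ₀) (ContDiff.contDiffOn (by fun_prop))
      fun x hx => h x (subset_closure hx)
  · exact ContinuousOn.congr (f := fun x : EuclideanSpace ℝ (Fin (d + 1)) =>
      q₀ * x (Fin.last d) + φ₀) (Continuous.continuousOn (by fun_prop)) h
  · intro x hx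
    have h1 : massFlux p B φ =ᶠ[𝓝 x] fun _ => density p B (q₀ ^ 2) • w := by
      filter_upwards [hΩo.mem_nhds hx] with y hy using hflux y hy
    rw [divergence, h1.fderiv_eq]
    simp
  · intro x hx ν hν
    rw [hw, inner_smul_left, EuclideanSpace.inner_single_left, hν.apply_last_eq_zero hS hx]
    simp
  · intro t
    have hset : {x' : EuclideanSpace ℝ (Fin d) | axialPoint x' t ∈ Ω} = S := by
      ext x'; simp [hΩ]
    rw [hset, setIntegral_congr_fun (g := fun _ => density p B (q₀ ^ 2) * q₀) hS.measurableSet,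
      setIntegral_const, smul_eq_mul, ← hm, mul_comm]
    intro x' hx'
    simp only
    rw [hflux _ (by simpa [hΩ] using hx'), hw]
    simp
  · intro x hx
    rw [hgrad x hx, hwn]
    exact (hq.subsonic_iff q₀ hq₀).2 hq₀'

theorem eqOn_uniform_of_gradient_eq {d : ℕ} {Ω : Set (EuclideanSpace ℝ (Fin (d + 1)))}
    (hΩ : IsOpen Ω) (hΩp : IsPreconnected Ω) {φ : EuclideanSpace ℝ (Fin (d + 1)) → ℝ} {q₀ : ℝ}
    (hφd : DifferentiableOn ℝ φ Ω) (hφc : ContinuousOn φ (closure Ω))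
    (hgrad : ∀ x ∈ Ω, gradient φ x = q₀ • EuclideanSpace.single (Fin.last d) (1 : ℝ)) :
    ∃ φ₀ : ℝ, ∀ x ∈ closure Ω, φ x = q₀ * x (Fin.last d) + φ₀ := by
  have hlin := hasGradientAt_uniform (d := d) q₀ 0
  have hφat : ∀ x ∈ Ω, DifferentiableAt ℝ φ x := fun x hx =>
    (hφd x hx).differentiableAt (hΩ.mem_nhds hx)
  have h0 : EqOn (fderiv ℝ fun x => φ x - (q₀ * x (Fin.last d) + 0)) 0 Ω := by
    intro x hx
    have h1 := (hφat x hx).hasGradientAt.hasFDerivAt.sub (hlin x).hasFDerivAt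
    have h2 : fderiv ℝ (fun x => φ x - (q₀ * x (Fin.last d) + 0)) x = _ := h1.fderiv
    rw [h2, hgrad x hx, sub_self]
    rfl
  obtain ⟨φ₀, hφ₀⟩ := hΩ.exists_is_const_of_fderiv_eq_zero hΩp
    (fun x hx => ((hφat x hx).sub (hlin x).hasFDerivAt.differentiableAt).differentiableWithinAt) h0
  have heq : EqOn φ (fun x => q₀ * x (Fin.last d) + φ₀) Ω := fun x hx => by
    have h1 : φ x - (q₀ * x (Fin.last d) + 0) = φ₀ := hφ₀ x hx
    simp only
    linarith
  exact ⟨φ₀, fun x hx => heq.of_subset_closure hφc (Continuous.continuousOn (by fun_prop))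
    subset_closure Subset.rfl hx⟩

/-! ### The main theorem -/

theorem mainTheorem3 (d : ℕ) (hd : 1 ≤ d)
    (p : ℝ → ℝ) (hp : IsPressureLaw p)
    (B : ℝ) (hB : ∃ r : ℝ, 0 < r ∧ enthalpy p r = B)
    (α : ℝ≥0) (hα₀ : 0 < α) (hα₁ : α < 1)
    (S : Set (EuclideanSpace ℝ (Fin d))) (hS : IsC2HolderOpen α S)
    (hSb : Bornology.IsBounded S) (hSsc : SimplyConnectedSpace S) :
    -- the critical speed
    ∃ qcr : ℝ, 0 < qcr ∧ (∀ q : ℝ, 0 ≤ q → (IsSubsonicSpeed p B q ↔ q < qcr)) ∧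
      ∀ m₀ : ℝ, 0 < m₀ →
        (m₀ / volume.real S < density p B (qcr ^ 2) * qcr →
          -- the subsonic speed with mass flux density `m₀ / |S|`
          ∃ q₀ : ℝ, (0 < q₀ ∧ q₀ < qcr ∧ density p B (q₀ ^ 2) * q₀ = m₀ / volume.real S) ∧
            (∀ q : ℝ, 0 < q → q < qcr → density p B (q ^ 2) * q = m₀ / volume.real S → q = q₀) ∧
            -- the solutions are exactly `q₀ xₙ + φ₀`
            (∀ φ : EuclideanSpace ℝ (Fin (d + 1)) → ℝ, IsNozzleFlow p B (straightCylinder S) m₀ φ ↔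
              ∃ φ₀ : ℝ, ∀ x ∈ closure (straightCylinder S), φ x = q₀ * x (Fin.last d) + φ₀) ∧
            -- and they are uniformly subsonic
            (∀ φ : EuclideanSpace ℝ (Fin (d + 1)) → ℝ, IsNozzleFlow p B (straightCylinder S) m₀ φ →
              ∃ q : ℝ, q < qcr ∧ ∀ x ∈ straightCylinder S, ‖gradient φ x‖ ≤ q)) ∧
        (density p B (qcr ^ 2) * qcr ≤ m₀ / volume.real S →
          ¬ ∃ φ : EuclideanSpace ℝ (Fin (d + 1)) → ℝ, IsNozzleFlow p B (straightCylinder S) m₀ φ) := by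
  obtain ⟨qcr, hq⟩ := hp.exists_isCriticalSpeed hB
  have hSo : IsOpen S := hS.1
  have hS1 : HasC1Boundary S := hS.hasC1Boundary
  have hSn : S.Nonempty := nonempty_coe_sort.1 inferInstance
  have hSp : IsPreconnected S := isPreconnected_iff_preconnectedSpace.2 inferInstance
  -- `d ≥ 1` enters here: a bounded set is not all of `ℝ^d`. A nonempty complement is needed for the
  -- distance to it to be positive inside.
  have hSc : Sᶜ.Nonempty := by
    have : Nonempty (Fin d) := ⟨⟨0, hd⟩⟩
    rw [nonempty_compl]
    rintro rfl
    exact NormedSpace.unbounded_univ ℝ (EuclideanSpace ℝ (Fin d)) hSb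
  have hvol : 0 < volume.real S :=
    ENNReal.toReal_pos (hSo.measure_pos volume hSn).ne' hSb.measure_lt_top.ne
  refine ⟨qcr, hq.pos, hq.subsonic_iff, fun m₀ hm₀ => ⟨fun hlt => ?_, ?_⟩⟩
  -- The flux density runs continuously from `0` at rest to its sonic value; `m₀ > 0` and the strict
  -- upper bound place `q₀` in the open interval.
  · obtain ⟨q₀, ⟨hq₀, hq₀'⟩, hq₀m⟩ := intermediate_value_Ioo hq.pos.le hq.flux_continuousOn
      ⟨show density p B (0 ^ 2) * 0 < m₀ / volume.real S by rw [mul_zero]; positivity, hlt⟩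
    simp only at hq₀m
    have hm : density p B (q₀ ^ 2) * q₀ * volume.real S = m₀ := by
      rw [hq₀m, div_mul_cancel₀ _ hvol.ne']
    have hgrad : ∀ φ : EuclideanSpace ℝ (Fin (d + 1)) → ℝ,
        IsNozzleFlow p B (straightCylinder S) m₀ φ → ∀ x ∈ straightCylinder S,
          gradient φ x = q₀ • EuclideanSpace.single (Fin.last d) (1 : ℝ) := fun φ hφ =>
      hφ.gradient_eq hq hSo hSb hSc hSn hSp hS1 ⟨hq₀.le, hq₀'.le⟩ hm
    refine ⟨q₀, ⟨hq₀, hq₀', hq₀m⟩, fun q h1 h2 h3 => ?_, fun φ => ⟨fun hφ => ?_, ?_⟩,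
      fun φ hφ => ⟨q₀, hq₀', fun x hx => ?_⟩⟩
    · exact hq.flux_strictMono.injOn ⟨h1.le, h2.le⟩ ⟨hq₀.le, hq₀'.le⟩ (h3.trans hq₀m.symm)
    · exact eqOn_uniform_of_gradient_eq (isOpen_straightCylinder hSo)
        (isPreconnected_straightCylinder hSp) (hφ.contDiffOn.differentiableOn two_ne_zero)
        hφ.continuousOn (hgrad φ hφ)
    · rintro ⟨φ₀, hφ₀⟩
      exact isNozzleFlow_uniform hq hSo hq₀.le hq₀' hm hφ₀
    · rw [hgrad φ hφ x hx, norm_smul]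
      simp [abs_of_pos hq₀]
  · rintro hle ⟨φ, hφ⟩
    have h1 := hφ.flux_lt hq hSo hSb hSn
    rw [le_div_iff₀ hvol] at hle
    linarith
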